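/- Let $\widetilde F_0$ be the central fibre of the semistable degeneration of the Fano surface of a cubic threefold to the Segre primal. It is a normal crossing surface with $21$ irreducible components: $D(i)$ for $1\le i\le 6$, and $B(j,k)$ for the two-element subsets $\{j,k\}\subset\{1,\dots,6\}$. They intersect as follows. - $D(m)\cap D(n)=\emptyset$ for $m\ne n$. - $B(i,j)\cap B(k,l)$, for $\{i,j\}\ne\{k,l\}$, is a curve if $\{i,j\}\cap\{k,l\}=\emptyset$, and is empty otherwise. - $D(m)\cap B(j,k)$ is a curve if $m\notin\{j,k\}$, and is empty otherwise. - $D(m)\cap B(i,j)\cap B(k,l)$, for $\{i,j\}\neq\{k,l\}$, is a point if $\{m\},\{i,j\},\{k,l\}$ are pairwise disjoint, and is empty otherwise. - Three distinct components $B$ have no common point, and neither do four distinct components. Let $\Lambda=\Lambda(\widetilde F_0)$ be the dual simplicial complex of this configuration: its vertices are the components, and a nonempty set of components spans a face if and only if these components have a common point. Let $KG(7,2)$ be the Kneser graph, whose vertices are the two-element subsets of $\{1,\dots,7\}$, two of them being adjacent if and only if they are disjoint. Then the following hold. 1. The map $D(i)\mapsto\{i,7\}$, $B(j,k)\mapsto\{j,k\}$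 is an isomorphism from the $1$-skeleton of $\Lambda$ onto $KG(7,2)$. Under it, the $2$-faces of $\Lambda$ are exactly the triangles of $KG(7,2)$ that have a vertex of the form $\{i,7\}$. The complex $\Lambda$ has no faces of dimension greater than $2$. 2. The geometric realization of $\Lambda$ is path connected, and its fundamental group (at any base point) is isomorphic to $\mathbb Z^{5}$. 3. The Betti numbers of $\Lambda$ are $h_1(\Lambda)=\dim_{\mathbb Q}H_1(\Lambda;\mathbb Q)=5$ and $h_2(\Lambda)=\dim_{\mathbb Q}H_2(\Lambda;\mathbb Q)=10$. -/

import Mathlib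

/-! ### Simplicial complexes: realization, 1-skeleton, homology -/

namespace AbstractSimplicialComplex

/-- The 1-skeleton: two distinct vertices are adjacent iff they span a face. -/
def oneSkeleton {V : Type*} [DecidableEq V] (K : AbstractSimplicialComplex V) :
    SimpleGraph V where
  Adj v w := v ≠ w ∧ {v, w} ∈ K.faces
  symm := ⟨fun v w h => ⟨h.1.symm, by rw [Finset.pair_comm]; exact h.2⟩⟩
  loopless := ⟨fun _ h => h.1 rfl⟩

/-- The geometric realization of a complex with finitely many vertices: the points of `ℝ^V` whose
coordinates are barycentric coordinates supported on a face, with the subspace topology. -/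
def realization {V : Type*} [Fintype V] (K : AbstractSimplicialComplex V) : Set (V → ℝ) :=
  {x | (∀ v, 0 ≤ x v) ∧ ∑ v, x v = 1 ∧ ∃ s ∈ K.faces, ∀ v, v ∉ s → x v = 0}

section Homology

variable {V : Type*} [LinearOrder V] (K : AbstractSimplicialComplex V)

/-- The `n`-simplices of `K`, oriented by the linear order of the vertices. -/
def Simplex (n : ℕ) : Type _ := {s : Finset V // s ∈ K.faces ∧ s.card = n + 1}

/-- The simplicial `n`-chains with rational coefficients. -/
abbrev Chain (n : ℕ) : Type _ := K.Simplex n →₀ ℚ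

variable {K}

/-- The facet of an `(n + 1)`-simplex opposite to its vertex `v`. -/
def Simplex.facet {n : ℕ} (s : K.Simplex (n + 1)) (v : V) (hv : v ∈ s.1) : K.Simplex n :=
  ⟨s.1.erase v, by
    have hc : (s.1.erase v).card = n + 1 := by rw [Finset.card_erase_of_mem hv, s.2.2]; rfl
    exact ⟨(K.isRelLowerSet_faces s.2.1).2 (Finset.erase_subset v s.1)
      (Finset.card_pos.mp (by omega)), hc⟩⟩

/-- The position of `v` in `s` when `s` is listed increasingly, starting from `0`. -/
def position (s : Finset V) (v : V) : ℕ := (s.filter (· < v)).card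

variable (K)

/-- The boundary map, `∂[v₀ < ⋯ < vₙ₊₁] = ∑ j, (-1)^j [v₀, …, v̂ⱼ, …, vₙ₊₁]`. -/
noncomputable def boundary (n : ℕ) : K.Chain (n + 1) →ₗ[ℚ] K.Chain n :=
  Finsupp.linearCombination ℚ fun s : K.Simplex (n + 1) =>
    ∑ v ∈ s.1.attach, Finsupp.single (s.facet v.1 v.2) ((-1 : ℚ) ^ position s.1 v.1)

/-- The cycles; in degree `0` every chain is a cycle. -/
noncomputable def cycles : (n : ℕ) → Submodule ℚ (K.Chain n)
  | 0 => ⊤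
  | n + 1 => LinearMap.ker (K.boundary n)

/-- The boundaries. -/
noncomputable def boundaries (n : ℕ) : Submodule ℚ (K.Chain n) :=
  LinearMap.range (K.boundary n)

lemma position_erase_of_lt (s : Finset V) {u v : V} (h : u < v) :
    position (s.erase v) u = position s u := by
  unfold position
  congr 1
  ext w
  simp only [Finset.mem_filter, Finset.mem_erase]
  exact ⟨fun hw => ⟨hw.1.2, hw.2⟩, fun hw => ⟨⟨(hw.2.trans h).ne, hw.1⟩, hw.2⟩⟩

lemma position_erase_add_one_of_lt (s : Finset V) {u v : V} (hu : u ∈ s) (h : u < v) :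
    position (s.erase u) v + 1 = position s v := by
  unfold position
  rw [Finset.filter_erase, Finset.card_erase_add_one]
  simp [hu, h]

/-- Boundaries are cycles. -/
lemma boundary_comp_boundary (n : ℕ) : K.boundary n ∘ₗ K.boundary (n + 1) = 0 := by
  apply Finsupp.lhom_ext'
  intro s
  apply LinearMap.ext_ring
  have key : ∀ t : K.Simplex n,
      (K.boundary n (K.boundary (n + 1) (Finsupp.single s 1))) t = 0 := by
    intro t
    simp only [boundary, Finsupp.linearCombination_single, one_smul, map_sum]
    simp only [Finset.smul_sum, Finsupp.smul_single, smul_eq_mul,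
      Finsupp.finsetSum_apply]
    rw [Finset.sum_sigma']
    refine Finset.sum_involution
      (fun p _ => ⟨⟨p.2.1, Finset.mem_of_mem_erase p.2.2⟩,
        ⟨p.1.1, Finset.mem_erase.mpr ⟨(Finset.ne_of_mem_erase p.2.2).symm, p.1.2⟩⟩⟩) ?_ ?_ ?_ ?_
    · rintro ⟨⟨v, hv⟩, ⟨u, hu⟩⟩ -
      have huv : u ≠ v := Finset.ne_of_mem_erase hu
      have hus : u ∈ s.1 := Finset.mem_of_mem_erase hu
      have hf : ((s.facet v hv).facet u hu) = ((s.facet u hus).facet v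
          (Finset.mem_erase.mpr ⟨huv.symm, hv⟩)) := by
        apply Subtype.ext
        exact Finset.erase_right_comm
      simp only
      rw [hf, ← Finsupp.add_apply, ← Finsupp.single_add]
      have hz : ((-1 : ℚ) ^ position s.1 v * (-1) ^ position (s.1.erase v) u
          + (-1) ^ position s.1 u * (-1) ^ position (s.1.erase u) v) = 0 := by
        rcases lt_or_gt_of_ne huv with h | h
        · rw [position_erase_of_lt s.1 h, ← position_erase_add_one_of_lt s.1 hus h]
          ring
        · rw [position_erase_of_lt s.1 h, ← position_erase_add_one_of_lt s.1 hv h]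
          ring
      change (Finsupp.single _ ((-1 : ℚ) ^ position s.1 v * (-1) ^ position (s.1.erase v) u
          + (-1) ^ position s.1 u * (-1) ^ position (s.1.erase u) v)) t = 0
      rw [hz]
      simp
    · rintro ⟨⟨v, hv⟩, ⟨u, hu⟩⟩ - - h
      have huv : u ≠ v := Finset.ne_of_mem_erase hu
      exact huv (congrArg (fun p => p.1.1) h)
    · intro p _
      exact Finset.mem_sigma.mpr ⟨Finset.mem_attach _ _, Finset.mem_attach _ _⟩
    · intro p _
      rfl
  ext t
  exact key t

lemma boundaries_le_cycles (n : ℕ) : K.boundaries n ≤ K.cycles n := by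
  cases n with
  | zero => exact le_top
  | succ n => exact LinearMap.range_le_ker_iff.mpr (K.boundary_comp_boundary n)

/-- Simplicial homology with rational coefficients: cycles modulo boundaries. -/
abbrev Homology (n : ℕ) : Type _ := K.cycles n ⧸ (K.boundaries n).submoduleOf (K.cycles n)

/-- The `n`-th Betti number. -/
noncomputable def betti (n : ℕ) : ℕ := Module.finrank ℚ (K.Homology n)

end Homology

/-- The dual complex of a family of nonempty sets (the components): its vertices are the
components, and finitely many of them span a face iff they have a common point. -/
def dual {ι X : Type*} (C : ι → Set X) (hC : ∀ i, (C i).Nonempty) :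
    AbstractSimplicialComplex ι where
  faces := {s | s.Nonempty ∧ (⋂ i ∈ s, C i).Nonempty}
  isRelLowerSet_faces := fun _ hs => ⟨hs.1, fun _ hts ht =>
    ⟨ht, hs.2.mono (Set.biInter_subset_biInter_left hts)⟩⟩
  singleton_mem := fun v => ⟨Finset.singleton_nonempty v, by simpa using hC v⟩

end AbstractSimplicialComplex

/-! ### Kneser graphs -/

/-- The `n`-element subsets of an `m`-element set of labels. -/
abbrev KSubset (m n : ℕ) : Type := {s : Finset (Fin m) // s.card = n}

/-- The Kneser graph `KG(m, n)`: vertices are the `n`-subsets of an `m`-set, adjacent iff they are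
disjoint (and distinct, which is automatic when `n ≠ 0`). -/
def kneserGraph (m n : ℕ) : SimpleGraph (KSubset m n) where
  Adj s t := s ≠ t ∧ Disjoint s.1 t.1
  symm := ⟨fun _ _ h => ⟨h.1.symm, h.2.symm⟩⟩
  loopless := ⟨fun _ h => h.1 rfl⟩

/-! ### The central fibre and its dual complex

The labels `1, …, 6` are the elements of `Fin 6`, and `1, …, 7` those of `Fin 7`; the label `7`
is `Fin.last 6`. -/

namespace FanoFibre

/-- The 21 components: the six del Pezzo surfaces `D(m)` and the fifteen blown-up planes `B(j,k)`. -/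
inductive Component : Type
  | D (m : Fin 6)
  | B (s : KSubset 6 2)
  deriving DecidableEq, Fintype

/-- The strata of the central fibre. Every point of the fibre lies in the relative interior of
exactly one of them:
* `comp c`: a component;
* `E {s, t}`: the double curve `E[s, t] = B(s) ∩ B(t)`, for disjoint pairs `s, t`;
* `R m s`: the double curve `R(m, s) = D(m) ∩ B(s)`, for `m ∉ s`;
* `N m {s, t}`: the triple point `N(m, [s, t]) = D(m) ∩ B(s) ∩ B(t)`, for disjoint `s, t` not
  containing `m`. -/
inductive Stratum : Type
  | comp (c : Component)
  | E (e : (kneserGraph 6 2).edgeSet)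
  | R (m : Fin 6) (s : KSubset 6 2) (h : m ∉ s.1)
  | N (m : Fin 6) (e : (kneserGraph 6 2).edgeSet) (h : ∀ s ∈ e.1, m ∉ s.1)

/-- The components on which a stratum lies. -/
def Stratum.components : Stratum → Set Component
  | .comp c => {c}
  | .E e => Component.B '' {s | s ∈ e.1}
  | .R m s _ => {.D m, .B s}
  | .N m e _ => {.D m} ∪ Component.B '' {s | s ∈ e.1}

/-- A component, as the set of (the relative interiors of) the strata that it contains. -/
def Component.strata (c : Component) : Set Stratum := {x | c ∈ x.components}

/-- The dual complex `Λ` of the central fibre. -/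
def dualComplex : AbstractSimplicialComplex Component :=
  AbstractSimplicialComplex.dual Component.strata fun c => ⟨.comp c, Set.mem_singleton c⟩

/-- The label of a component: `D(m)` has label `{m, 7}` and `B(j,k)` has label `{j, k}`. -/
def Component.label : Component → KSubset 7 2
  | .D m => ⟨{m.castSucc, Fin.last 6}, Finset.card_pair (Fin.castSucc_lt_last m).ne⟩
  | .B s => ⟨s.1.map Fin.castSuccEmb, by rw [Finset.card_map, s.2]⟩

/-- A numbering of the components: the label `{a, b}` is read as the binary number `2^a + 2^b`. -/
def Component.code (c : Component) : ℕ := ∑ a ∈ c.label.1, 2 ^ (a : ℕ)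

lemma Component.code_injective : Function.Injective Component.code := by
  decide

/-- The components are ordered through their numbering. The order only serves to orient the
simplices. -/
instance : LinearOrder Component where
  toPartialOrder := PartialOrder.lift Component.code Component.code_injective
  le_total a b := Nat.le_total a.code b.code
  toDecidableLE a b := Nat.decLe a.code b.code
  toDecidableLT a b := Nat.decLt a.code b.code
  toDecidableEq := instDecidableEqComponent

end FanoFibre

/-! Every maximal face is a triangle D(m), B(a), B(b) with {m}, a, b pairwise disjoint, and each
disjoint pair a, b admits exactly two such m. A group-valued cocycle is therefore determined by its
values on the 60 edges between a D and a B, subject to one relation for each of the 45 squares D(m),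
B(a), D(n), B(b). Normalising along a spanning tree trivialises 20 of these edges. Then 35 squares
express the remaining values through five elements, and the other 10 squares make these five
commute. This is `exists_hom_of_square`; undoing the normalisation gives `exists_gauge`: over an
arbitrary group G, every cocycle is, up to gauge, the image of `basicCocycle` under a homomorphism
ℤ⁵ → G.

For the fundamental group, take G = π₁ and the cocycle of edge loops of the cover by open stars. The
resulting homomorphism is onto up to conjugation, because every path is homotopic to a chain of
edges (`path_induction`). It is injective because each integral cocycle is realised by a
circle-valued function (`exists_winding_edge`), whose winding number reads off a coordinate;
independence of the five cocycles is `eq_zero_of_coboundary`.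

For H₁, take G to be the 1-chains modulo boundaries: the same gauge statement shows that a cycle
with vanishing periods bounds. Then h₂ follows by counting dimensions, since 21 - 105 + 90 = 1 - 5 +
10. -/

namespace AbstractSimplicialComplex

/-- A group-valued function on ordered pairs of vertices that is multiplicative on each face. -/
def IsCocycle {V G : Type*} [Group G] (K : AbstractSimplicialComplex V) (g : V → V → G) : Prop :=
  ∀ s ∈ K.faces, ∀ u ∈ s, ∀ v ∈ s, ∀ w ∈ s, g u v * g v w = g u w

end AbstractSimplicialComplex

/-! ### Faces of the dual complex and the Kneser graph. -/

namespace FanoFibre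

open Component

lemma mem_faces {t : Finset Component} :
    t ∈ dualComplex.faces ↔ t.Nonempty ∧ ∃ x : Stratum, ∀ c ∈ t, c ∈ x.components := by
  simp only [dualComplex, AbstractSimplicialComplex.dual, Set.mem_ofPred_eq, Set.Nonempty,
    Set.mem_iInter, Component.strata]

/-- Two pairs use at most four of the six labels. Hence every edge between two B's lies in a
triangle with some D. -/
lemma exists_notMem_pair (a b : KSubset 6 2) : ∃ m, m ∉ a.1 ∧ m ∉ b.1 := by
  have h : (a.1 ∪ b.1).card < (Finset.univ : Finset (Fin 6)).card :=
    (Finset.card_union_le _ _).trans_lt (by rw [a.2, b.2]; decide)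
  obtain ⟨m, -, hm⟩ := Finset.exists_mem_notMem_of_card_lt_card h
  exact ⟨m, by simpa using hm⟩

lemma exists_disjoint_notMem (a : KSubset 6 2) (m : Fin 6) :
    ∃ b : KSubset 6 2, Disjoint a.1 b.1 ∧ m ∉ b.1 := by
  have h : 2 ≤ (insert m a.1)ᶜ.card := by
    have := Finset.card_insert_le m a.1
    rw [a.2] at this
    rw [Finset.card_compl, Fintype.card_fin]
    omega
  obtain ⟨b, hb, hc⟩ := Finset.exists_subset_card_eq h
  refine ⟨⟨b, hc⟩, ?_, fun hm => by simpa using hb hm⟩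
  exact Finset.disjoint_left.mpr fun x hx hx' => by simpa [hx] using hb hx'

lemma facet_mem_faces {m : Fin 6} {a b : KSubset 6 2} (hab : Disjoint a.1 b.1)
    (ha : m ∉ a.1) (hb : m ∉ b.1) : {D m, B a, B b} ∈ dualComplex.faces := by
  have hne : a ≠ b := by
    rintro rfl
    have := a.2
    simp [disjoint_self.mp hab] at this
  refine mem_faces.mpr ⟨by simp, .N m ⟨s(a, b), ⟨hne, hab⟩⟩ ?_, ?_⟩
  · intro s hs
    rcases Sym2.mem_iff.mp hs with rfl | rfl <;> assumption
  · simp [Stratum.components]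

/-- Every face lies in a triangle `D(m), B(a), B(b)`. -/
lemma exists_facet {t : Finset Component} (ht : t ∈ dualComplex.faces) :
    ∃ m a b, Disjoint a.1 b.1 ∧ m ∉ a.1 ∧ m ∉ b.1 ∧ t ⊆ {D m, B a, B b} := by
  obtain ⟨-, x, hx⟩ := mem_faces.mp ht
  rcases x with c | ⟨e, he⟩ | ⟨m, a, h⟩ | ⟨m, ⟨e, he⟩, h⟩
  · rcases c with m | a
    -- The pair {0, 1} is arbitrary; only the avoidance of m is kept.
    · obtain ⟨a, -, ha⟩ := exists_disjoint_notMem ⟨{0, 1}, rfl⟩ m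
      obtain ⟨b, hab, hb⟩ := exists_disjoint_notMem a m
      refine ⟨m, a, b, hab, ha, hb, fun c hc => ?_⟩
      have := hx c hc
      simp_all [Stratum.components]
    · obtain ⟨m, hm, -⟩ := exists_notMem_pair a a
      obtain ⟨b, hab, hb⟩ := exists_disjoint_notMem a m
      refine ⟨m, a, b, hab, hm, hb, fun c hc => ?_⟩
      have := hx c hc
      simp_all [Stratum.components]
  · induction e using Sym2.ind with | _ a b =>
    obtain ⟨m, ha, hb⟩ := exists_notMem_pair a b
    refine ⟨m, a, b, he.2, ha, hb, fun c hc => ?_⟩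
    have := hx c hc
    simp only [Stratum.components, Sym2.mem_iff, Set.mem_image, Set.mem_ofPred_eq] at this
    obtain ⟨s, rfl | rfl, rfl⟩ := this <;> simp
  · obtain ⟨b, hab, hb⟩ := exists_disjoint_notMem a m
    refine ⟨m, a, b, hab, h, hb, fun c hc => ?_⟩
    have := hx c hc
    simp only [Stratum.components, Set.mem_insert_iff, Set.mem_singleton_iff] at this
    rcases this with rfl | rfl <;> simp
  · induction e using Sym2.ind with | _ a b =>
    refine ⟨m, a, b, he.2, h a (by simp), h b (by simp), fun c hc => ?_⟩
    have := hx c hc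
    simp only [Stratum.components, Sym2.mem_iff, Set.mem_union, Set.mem_image,
      Set.mem_ofPred_eq, Set.mem_singleton_iff] at this
    obtain rfl | ⟨s, rfl | rfl, rfl⟩ := this <;> simp

lemma mem_faces_iff_subset {t : Finset Component} : t ∈ dualComplex.faces ↔
    t.Nonempty ∧ ∃ m a b, Disjoint a.1 b.1 ∧ m ∉ a.1 ∧ m ∉ b.1 ∧ t ⊆ {D m, B a, B b} := by
  refine ⟨fun h => ⟨(mem_faces.mp h).1, exists_facet h⟩, ?_⟩
  rintro ⟨hne, m, a, b, hab, ha, hb, hs⟩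
  exact (dualComplex.isRelLowerSet_faces (facet_mem_faces hab ha hb)).2 hs hne

lemma castSucc_ne_six : ∀ i : Fin 6, i.castSucc ≠ 6 := by decide

lemma disjoint_label_D_D (m n : Fin 6) : ¬ Disjoint (D m).label.1 (D n).label.1 := by
  simp [Component.label]

lemma disjoint_label_D_B {m : Fin 6} {a : KSubset 6 2} :
    Disjoint (D m).label.1 (B a).label.1 ↔ m ∉ a.1 := by
  simp +contextual [Component.label, castSucc_ne_six]

lemma disjoint_label_B_B {a b : KSubset 6 2} :
    Disjoint (B a).label.1 (B b).label.1 ↔ Disjoint a.1 b.1 := by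
  simp [Component.label]

lemma last_mem_label {c : Component} : Fin.last 6 ∈ c.label.1 ↔ ∃ m, c = D m := by
  rcases c with m | a <;> simp [Component.label, castSucc_ne_six]

/-- Labels of two D's share 7, so disjointness leaves the mixed and B-B cases, and each such pair
extends to a maximal triangle. Conversely, the three labels of a maximal triangle are pairwise
disjoint. -/
lemma disjoint_label_iff {v w : Component} :
    Disjoint v.label.1 w.label.1 ↔ v ≠ w ∧ {v, w} ∈ dualComplex.faces := by
  have hBne : ∀ a : KSubset 6 2, a.1.Nonempty := fun a =>
    Finset.card_pos.mp (by rw [a.2]; decide)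
  constructor
  · intro h
    refine ⟨?_, ?_⟩
    · rintro rfl
      have := v.label.2
      simp [disjoint_self.mp h] at this
    rw [mem_faces_iff_subset]
    refine ⟨by simp, ?_⟩
    rcases v with m | a <;> rcases w with n | b
    · exact absurd h (disjoint_label_D_D m n)
    · have hm := disjoint_label_D_B.mp h
      obtain ⟨c, hc, hc'⟩ := exists_disjoint_notMem b m
      exact ⟨m, b, c, hc, hm, hc', by intro; simp; tauto⟩
    · have hm := disjoint_label_D_B.mp h.symm
      obtain ⟨c, hc, hc'⟩ := exists_disjoint_notMem a n
      exact ⟨n, a, c, hc, hm, hc', by intro; simp; tauto⟩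
    · obtain ⟨m, ha, hb⟩ := exists_notMem_pair a b
      exact ⟨m, a, b, disjoint_label_B_B.mp h, ha, hb, by intro; simp; tauto⟩
  · rintro ⟨hne, h⟩
    obtain ⟨m, a, b, hab, ha, hb, hs⟩ := exists_facet h
    have hv : v ∈ ({D m, B a, B b} : Finset Component) := hs (by simp)
    have hw : w ∈ ({D m, B a, B b} : Finset Component) := hs (by simp)
    have h1 := disjoint_label_D_B.mpr ha
    have h2 := disjoint_label_D_B.mpr hb
    have h3 := disjoint_label_B_B.mpr hab
    simp only [Finset.mem_insert, Finset.mem_singleton] at hv hw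
    rcases hv with rfl | rfl | rfl <;> rcases hw with rfl | rfl | rfl <;>
      first | exact absurd rfl hne | assumption | (apply Disjoint.symm; assumption)

lemma label_bijective : Function.Bijective Component.label :=
  (Fintype.bijective_iff_injective_and_card _).mpr ⟨by decide +kernel, by decide +kernel⟩

/-- The labelling, as an isomorphism from the 1-skeleton onto the Kneser graph. -/
noncomputable def labelIso : dualComplex.oneSkeleton ≃g kneserGraph 7 2 where
  toEquiv := Equiv.ofBijective _ label_bijective
  map_rel_iff' := by
    intro v w
    simp only [Equiv.ofBijective_apply, kneserGraph, AbstractSimplicialComplex.oneSkeleton,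
      disjoint_label_iff, label_bijective.1.ne_iff]
    tauto

lemma card_le_three {t : Finset Component} (ht : t ∈ dualComplex.faces) : t.card ≤ 3 := by
  obtain ⟨m, a, b, -, -, -, hs⟩ := exists_facet ht
  exact (Finset.card_le_card hs).trans Finset.card_le_three

/-- A label containing 7 belongs to a D; disjointness from it forces the other two vertices to be
B's, and the triangle is then maximal. -/
lemma triangle_mem_faces_iff {t : Finset Component} (ht : t.card = 3) :
    t ∈ dualComplex.faces ↔
      (∀ v ∈ t, ∀ w ∈ t, v ≠ w → Disjoint v.label.1 w.label.1) ∧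
        ∃ v ∈ t, Fin.last 6 ∈ v.label.1 := by
  constructor
  · intro h
    refine ⟨fun v hv w hw hne => disjoint_label_iff.mpr ⟨hne,
      (dualComplex.isRelLowerSet_faces h).2 (by intro; simp; rintro (rfl | rfl) <;> assumption)
        (by simp)⟩, ?_⟩
    obtain ⟨m, a, b, -, -, -, hs⟩ := exists_facet h
    have := Finset.eq_of_subset_of_card_le hs (Finset.card_le_three.trans ht.ge)
    exact ⟨D m, by simp [this], last_mem_label.mpr ⟨m, rfl⟩⟩
  · rintro ⟨hd, v, hv, hv'⟩
    obtain ⟨m, rfl⟩ := last_mem_label.mp hv'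
    have hc : (t.erase (D m)).card = 2 := by rw [Finset.card_erase_of_mem hv, ht]
    obtain ⟨x, y, hxy, he⟩ := Finset.card_eq_two.mp hc
    have hx : x ∈ t.erase (D m) := by simp [he]
    have hy : y ∈ t.erase (D m) := by simp [he]
    rw [Finset.mem_erase] at hx hy
    have h1 := hd _ hv _ hx.2 hx.1.symm
    have h2 := hd _ hv _ hy.2 hy.1.symm
    have h3 := hd _ hx.2 _ hy.2 hxy
    rcases x with n | a
    · exact absurd h1 (disjoint_label_D_D m n)
    rcases y with n | b
    · exact absurd h2 (disjoint_label_D_D m n)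
    rw [← Finset.insert_erase hv, he]
    exact facet_mem_faces (disjoint_label_B_B.mp h3) (disjoint_label_D_B.mp h1)
      (disjoint_label_D_B.mp h2)

end FanoFibre

/-! ### The square relations and their solution by five commuting elements. -/

namespace FanoFibre

open Component

/-- A two-element subset of the labels. -/
abbrev pair (i j : Fin 6) (h : i ≠ j := by decide) : KSubset 6 2 := ⟨{i, j}, Finset.card_pair h⟩

lemma eq_pair : ∀ a : KSubset 6 2,
    a = pair 0 1 ∨ a = pair 0 2 ∨ a = pair 0 3 ∨ a = pair 0 4 ∨ a = pair 0 5 ∨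
    a = pair 1 2 ∨ a = pair 1 3 ∨ a = pair 1 4 ∨ a = pair 1 5 ∨ a = pair 2 3 ∨
    a = pair 2 4 ∨ a = pair 2 5 ∨ a = pair 3 4 ∨ a = pair 3 5 ∨ a = pair 4 5 := by
  decide +kernel

lemma eq_label : ∀ m : Fin 6, m = 0 ∨ m = 1 ∨ m = 2 ∨ m = 3 ∨ m = 4 ∨ m = 5 := by decide

/-- A two-element subset of the labels, read as a binary number. -/
def pairCode (a : KSubset 6 2) : ℕ := ∑ i ∈ a.1, 2 ^ (i : ℕ)

/-- The places where the `i`-th basic cocycle takes the value `1`. -/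
def plusSupport : Fin 5 → List (Fin 6 × ℕ) :=
  ![[(4, 3), (4, 40), (0, 40), (0, 18), (1, 17), (1, 40)],
    [(4, 12), (3, 20), (2, 24), (2, 34), (3, 34), (4, 34)],
    [(2, 17), (4, 5), (0, 20)],
    [(2, 9), (3, 5), (0, 12)],
    [(5, 20), (4, 36), (2, 48)]]

/-- The places where the `i`-th basic cocycle takes the value `-1`. -/
def minusSupport : Fin 5 → List (Fin 6 × ℕ) :=
  ![[(3, 36), (5, 12)],
    [(1, 33), (5, 3)],
    [(5, 10), (1, 40), (3, 34)],
    [(5, 18), (1, 48), (4, 34)],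
    [(1, 9), (0, 10), (3, 3)]]

/-- The values of the five basic cocycles on the edges from `D(m)` to `B(a)`. -/
def weight (m : Fin 6) (a : KSubset 6 2) : Fin 5 → ℤ := fun i =>
  (if (m, pairCode a) ∈ plusSupport i then 1 else 0) -
    if (m, pairCode a) ∈ minusSupport i then 1 else 0

/-- The tables record exponents of the five generators in the universal solution of the square
relations. This finite check is what lets the weights extend to the B-B edges independently of m. -/
lemma weight_square : ∀ a b : KSubset 6 2, Disjoint a.1 b.1 → ∀ m, m ∉ a.1 → m ∉ b.1 →
    ∀ n, n ∉ a.1 → n ∉ b.1 → ∀ i,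
      weight m b i - weight m a i = weight n b i - weight n a i := by
  decide +kernel

/-- This and the next two lemmas cover the shapes that the ten leftover square relations take after
substitution. -/
lemma commute_of_eq_conj {G : Type*} [Group G] {x y : G} (h : x = y * x * y⁻¹) : Commute x y :=
  eq_mul_inv_iff_mul_eq.mp h

lemma commute_of_eq_conj_inv {G : Type*} [Group G] {x y : G} (h : x = y⁻¹ * x * y) :
    Commute x y := by
  simpa using commute_of_eq_conj (y := y⁻¹) (by simpa using h)

lemma commute_of_one_eq {G : Type*} [Group G] {x y : G} (h : 1 = y * x⁻¹ * (y⁻¹ * x)) :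
    Commute x y := by
  have := commute_of_eq_conj (x := x⁻¹) (y := y) 
    (eq_inv_of_mul_eq_one_left (by simpa [mul_assoc] using h.symm)).symm
  simpa using this

section Hom

variable {G : Type*} [Group G]

/-- The homomorphism from `ℤ⁵` given by five commuting elements. -/
def commHom (z : Fin 5 → G) (hz : ∀ i j, Commute (z i) (z j)) :
    Multiplicative (Fin 5 → ℤ) →* G where
  toFun v := z 0 ^ v.toAdd 0 * (z 1 ^ v.toAdd 1 * (z 2 ^ v.toAdd 2 *
    (z 3 ^ v.toAdd 3 * z 4 ^ v.toAdd 4)))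
  map_one' := by simp
  map_mul' v w := by
    have key : ∀ (i j : Fin 5) (m n : ℤ), Commute (z i ^ m) (z j ^ n) := fun i j m n =>
      (hz i j).zpow_zpow m n
    simp only [toAdd_mul, Pi.add_apply, zpow_add]
    rw [(key 3 4 _ _).mul_mul_mul_comm,
      ((key 2 3 _ _).mul_right (key 2 4 _ _)).mul_mul_mul_comm,
      ((key 1 2 _ _).mul_right ((key 1 3 _ _).mul_right (key 1 4 _ _))).mul_mul_mul_comm,
      ((key 0 1 _ _).mul_right ((key 0 2 _ _).mul_right
        ((key 0 3 _ _).mul_right (key 0 4 _ _)))).mul_mul_mul_comm]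

end Hom

/-- A solution of the square relations that is normalised along a spanning tree is given by
five commuting elements. -/
lemma exists_hom_of_square {G : Type*} [Group G] (h : Fin 6 → KSubset 6 2 → G)
    (rel : ∀ a b : KSubset 6 2, ∀ m n, Disjoint a.1 b.1 → m ∉ a.1 → m ∉ b.1 → n ∉ a.1 → n ∉ b.1 →
      h m a = h m b * (h n b)⁻¹ * h n a)
    (h2_35 : h 2 (pair 3 5) = 1)
    (h3_04 : h 3 (pair 0 4) = 1)
    (h2_13 : h 2 (pair 1 3) = 1)
    (h4_12 : h 4 (pair 1 2) = 1)
    (h0_12 : h 0 (pair 1 2) = 1)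
    (h0_25 : h 0 (pair 2 5) = 1)
    (h5_03 : h 5 (pair 0 3) = 1)
    (h4_03 : h 4 (pair 0 3) = 1)
    (h0_45 : h 0 (pair 4 5) = 1)
    (h3_14 : h 3 (pair 1 4) = 1)
    (h4_13 : h 4 (pair 1 3) = 1)
    (h2_01 : h 2 (pair 0 1) = 1)
    (h0_15 : h 0 (pair 1 5) = 1)
    (h1_25 : h 1 (pair 2 5) = 1)
    (h1_23 : h 1 (pair 2 3) = 1)
    (h1_34 : h 1 (pair 3 4) = 1)
    (h2_05 : h 2 (pair 0 5) = 1)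
    (h1_02 : h 1 (pair 0 2) = 1)
    (h2_14 : h 2 (pair 1 4) = 1)
    (h1_24 : h 1 (pair 2 4) = 1) :
    ∃ Z : Multiplicative (Fin 5 → ℤ) →* G,
      ∀ m a, m ∉ a.1 → h m a = Z (Multiplicative.ofAdd (weight m a)) := by
  -- Five edges outside the tree serve as generators. The squares below are ordered so that each has
  -- three sides already known and determines the fourth.
  let z : Fin 5 → G := ![h 4 (pair 0 1), h 4 (pair 2 3), h 2 (pair 0 4), h 2 (pair 0 3), h 5 (pair 2 4)]
  have h5_12 : h 5 (pair 1 2) = 1 := by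
    simp [rel (pair 1 2) (pair 0 3) 5 4 (by decide) (by decide) (by decide) (by decide) (by decide),
      h5_03, h4_03, h4_12]
  have h4_05 : h 4 (pair 0 5) = 1 := by
    simp [rel (pair 0 5) (pair 1 3) 4 2 (by decide) (by decide) (by decide) (by decide) (by decide),
      h4_13, h2_13, h2_05]
  have h3_05 : h 3 (pair 0 5) = 1 := by
    simp [rel (pair 0 5) (pair 1 4) 3 2 (by decide) (by decide) (by decide) (by decide) (by decide),
      h3_14, h2_14, h2_05]
  have h3_12 : h 3 (pair 1 2) = 1 := by
    simp [rel (pair 1 2) (pair 0 5) 3 4 (by decide) (by decide) (by decide) (by decide) (by decide),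
      h3_05, h4_05, h4_12]
  have h5_04 : h 5 (pair 0 4) = 1 := by
    simp [rel (pair 0 4) (pair 1 2) 5 3 (by decide) (by decide) (by decide) (by decide) (by decide),
      h5_12, h3_12, h3_04]
  have h3_45 : h 3 (pair 4 5) = 1 := by
    simp [rel (pair 4 5) (pair 1 2) 3 0 (by decide) (by decide) (by decide) (by decide) (by decide),
      h3_12, h0_12, h0_45]
  have h0_34 : h 0 (pair 3 4) = 1 := by
    simp [rel (pair 3 4) (pair 2 5) 0 1 (by decide) (by decide) (by decide) (by decide) (by decide),
      h0_25, h1_25, h1_34]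
  have h5_34 : h 5 (pair 3 4) = 1 := by
    simp [rel (pair 3 4) (pair 1 2) 5 0 (by decide) (by decide) (by decide) (by decide) (by decide),
      h5_12, h0_12, h0_34]
  have h5_02 : h 5 (pair 0 2) = 1 := by
    simp [rel (pair 0 2) (pair 3 4) 5 1 (by decide) (by decide) (by decide) (by decide) (by decide),
      h5_34, h1_34, h1_02]
  have h4_01 : h 4 (pair 0 1) = z 0 := rfl
  have h4_35 : h 4 (pair 3 5) = z 0 := by
    simp [rel (pair 3 5) (pair 0 1) 4 2 (by decide) (by decide) (by decide) (by decide) (by decide),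
      h4_01, h2_01, h2_35]
  have h0_35 : h 0 (pair 3 5) = z 0 := by
    simp [rel (pair 3 5) (pair 1 2) 0 4 (by decide) (by decide) (by decide) (by decide) (by decide),
      h0_12, h4_12, h4_35]
  have h0_14 : h 0 (pair 1 4) = z 0 := by
    simp [rel (pair 1 4) (pair 3 5) 0 2 (by decide) (by decide) (by decide) (by decide) (by decide),
      h0_35, h2_35, h2_14]
  have h3_25 : h 3 (pair 2 5) = (z 0)⁻¹ := by
    simp [rel (pair 2 5) (pair 1 4) 3 0 (by decide) (by decide) (by decide) (by decide) (by decide),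
      h3_14, h0_14, h0_25]
  have h1_04 : h 1 (pair 0 4) = z 0 := by
    simp [rel (pair 0 4) (pair 2 5) 1 3 (by decide) (by decide) (by decide) (by decide) (by decide),
      h1_25, h3_25, h3_04]
  have h5_23 : h 5 (pair 2 3) = (z 0)⁻¹ := by
    simp [rel (pair 2 3) (pair 0 4) 5 1 (by decide) (by decide) (by decide) (by decide) (by decide),
      h5_04, h1_04, h1_23]
  have h4_23 : h 4 (pair 2 3) = z 1 := rfl
  have h1_05 : h 1 (pair 0 5) = (z 1)⁻¹ := by
    simp [rel (pair 0 5) (pair 2 3) 1 4 (by decide) (by decide) (by decide) (by decide) (by decide),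
      h1_23, h4_23, h4_05]
  have h3_24 : h 3 (pair 2 4) = z 1 := by
    simp [rel (pair 2 4) (pair 0 5) 3 1 (by decide) (by decide) (by decide) (by decide) (by decide),
      h3_05, h1_05, h1_24]
  have h2_34 : h 2 (pair 3 4) = z 1 := by
    simp [rel (pair 3 4) (pair 0 5) 2 1 (by decide) (by decide) (by decide) (by decide) (by decide),
      h2_05, h1_05, h1_34]
  have h5_01 : h 5 (pair 0 1) = (z 1)⁻¹ := by
    simp [rel (pair 0 1) (pair 3 4) 5 2 (by decide) (by decide) (by decide) (by decide) (by decide),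
      h5_34, h2_34, h2_01]
  have h2_15 : h 2 (pair 1 5) = z 1 := by
    simp [rel (pair 1 5) (pair 3 4) 2 0 (by decide) (by decide) (by decide) (by decide) (by decide),
      h2_34, h0_34, h0_15]
  have h2_04 : h 2 (pair 0 4) = z 2 := rfl
  have h5_13 : h 5 (pair 1 3) = (z 2)⁻¹ := by
    simp [rel (pair 1 3) (pair 0 4) 5 2 (by decide) (by decide) (by decide) (by decide) (by decide),
      h5_04, h2_04, h2_13]
  have h4_02 : h 4 (pair 0 2) = z 2 := by
    simp [rel (pair 0 2) (pair 1 3) 4 5 (by decide) (by decide) (by decide) (by decide) (by decide),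
      h4_13, h5_13, h5_02]
  have h1_35 : h 1 (pair 3 5) = (z 2)⁻¹ * z 0 := by
    simp [rel (pair 3 5) (pair 0 2) 1 4 (by decide) (by decide) (by decide) (by decide) (by decide),
      h1_02, h4_02, h4_35]
  have h0_24 : h 0 (pair 2 4) = z 2 := by
    simp [rel (pair 2 4) (pair 3 5) 0 1 (by decide) (by decide) (by decide) (by decide) (by decide),
      h0_35, h1_35, h1_24]
  have h3_15 : h 3 (pair 1 5) = (z 2)⁻¹ * z 1 := by
    simp [rel (pair 1 5) (pair 0 4) 3 2 (by decide) (by decide) (by decide) (by decide) (by decide),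
      h3_04, h2_04, h2_15]
  have h2_03 : h 2 (pair 0 3) = z 3 := rfl
  have h5_14 : h 5 (pair 1 4) = (z 3)⁻¹ := by
    simp [rel (pair 1 4) (pair 0 3) 5 2 (by decide) (by decide) (by decide) (by decide) (by decide),
      h5_03, h2_03, h2_14]
  have h3_02 : h 3 (pair 0 2) = z 3 := by
    simp [rel (pair 0 2) (pair 1 4) 3 5 (by decide) (by decide) (by decide) (by decide) (by decide),
      h3_14, h5_14, h5_02]
  have h1_45 : h 1 (pair 4 5) = (z 3)⁻¹ := by
    simp [rel (pair 4 5) (pair 0 2) 1 3 (by decide) (by decide) (by decide) (by decide) (by decide),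
      h1_02, h3_02, h3_45]
  have h0_23 : h 0 (pair 2 3) = z 3 := by
    simp [rel (pair 2 3) (pair 4 5) 0 1 (by decide) (by decide) (by decide) (by decide) (by decide),
      h0_45, h1_45, h1_23]
  have h4_15 : h 4 (pair 1 5) = (z 3)⁻¹ * z 1 := by
    simp [rel (pair 1 5) (pair 0 3) 4 2 (by decide) (by decide) (by decide) (by decide) (by decide),
      h4_03, h2_03, h2_15]
  have h5_24 : h 5 (pair 2 4) = z 4 := rfl
  have h1_03 : h 1 (pair 0 3) = (z 4)⁻¹ := by
    simp [rel (pair 0 3) (pair 2 4) 1 5 (by decide) (by decide) (by decide) (by decide) (by decide),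
      h1_24, h5_24, h5_03]
  have h4_25 : h 4 (pair 2 5) = z 4 := by
    simp [rel (pair 2 5) (pair 0 3) 4 1 (by decide) (by decide) (by decide) (by decide) (by decide),
      h4_03, h1_03, h1_25]
  have h0_13 : h 0 (pair 1 3) = (z 4)⁻¹ := by
    simp [rel (pair 1 3) (pair 2 5) 0 4 (by decide) (by decide) (by decide) (by decide) (by decide),
      h0_25, h4_25, h4_13]
  have h2_45 : h 2 (pair 4 5) = z 4 := by
    simp [rel (pair 4 5) (pair 1 3) 2 0 (by decide) (by decide) (by decide) (by decide) (by decide),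
      h2_13, h0_13, h0_45]
  have h3_01 : h 3 (pair 0 1) = (z 4)⁻¹ := by
    simp [rel (pair 0 1) (pair 4 5) 3 2 (by decide) (by decide) (by decide) (by decide) (by decide),
      h3_45, h2_45, h2_01]
  -- All 60 edges are now known. Each of the ten squares not yet used closes up to a commutation
  -- relation, one for each pair of generators.
  have c01 : Commute (z 0) (z 1) := by
    have e := rel (pair 0 1) (pair 2 3) 4 5 (by decide) (by decide) (by decide) (by decide) (by decide)
    simp [h4_01, h4_23, h5_23, h5_01] at e
    exact commute_of_eq_conj e
  have c14 : Commute (z 1) (z 4) := by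
    have e := rel (pair 0 1) (pair 2 4) 3 5 (by decide) (by decide) (by decide) (by decide) (by decide)
    simp [h3_01, h3_24, h5_24, h5_01] at e
    simpa using (commute_of_eq_conj e).symm
  have c04 : Commute (z 0) (z 4) := by
    have e := rel (pair 0 1) (pair 2 5) 3 4 (by decide) (by decide) (by decide) (by decide) (by decide)
    simp [h3_01, h3_25, h4_25, h4_01] at e
    simpa using (commute_of_eq_conj_inv e).symm
  have c23 : Commute (z 2) (z 3) := by
    have e := rel (pair 0 2) (pair 1 5) 3 4 (by decide) (by decide) (by decide) (by decide) (by decide)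
    simp [h3_02, h3_15, h4_15, h4_02] at e
    exact (commute_of_eq_conj_inv e).symm
  have c34 : Commute (z 3) (z 4) := by
    have e := rel (pair 0 3) (pair 4 5) 1 2 (by decide) (by decide) (by decide) (by decide) (by decide)
    simp [h1_03, h1_45, h2_45, h2_03] at e
    simpa using (commute_of_eq_conj_inv e).symm
  have c02 : Commute (z 0) (z 2) := by
    have e := rel (pair 0 4) (pair 3 5) 1 2 (by decide) (by decide) (by decide) (by decide) (by decide)
    simp [h1_04, h1_35, h2_35, h2_04] at e
    exact commute_of_eq_conj_inv e
  have c24 : Commute (z 2) (z 4) := by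
    have e := rel (pair 1 3) (pair 2 4) 0 5 (by decide) (by decide) (by decide) (by decide) (by decide)
    simp [h0_13, h0_24, h5_24, h5_13] at e
    simpa using (commute_of_eq_conj e).symm
  have c03 : Commute (z 0) (z 3) := by
    have e := rel (pair 1 4) (pair 2 3) 0 5 (by decide) (by decide) (by decide) (by decide) (by decide)
    simp [h0_14, h0_23, h5_23, h5_14] at e
    exact commute_of_eq_conj e
  have c13 : Commute (z 1) (z 3) := by
    have e := rel (pair 1 5) (pair 2 3) 0 4 (by decide) (by decide) (by decide) (by decide) (by decide)
    simp [h0_15, h0_23, h4_23, h4_15] at e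
    exact commute_of_one_eq e
  have c12 : Commute (z 1) (z 2) := by
    have e := rel (pair 1 5) (pair 2 4) 0 3 (by decide) (by decide) (by decide) (by decide) (by decide)
    simp [h0_15, h0_24, h3_24, h3_15] at e
    exact commute_of_one_eq e
  have hz : ∀ i j, Commute (z i) (z j) := by
    intro i j
    fin_cases i <;> fin_cases j <;> first
      | exact Commute.refl _ | assumption | (apply Commute.symm; assumption)
  refine ⟨commHom z hz, fun m a hm => ?_⟩
  rcases eq_pair a with rfl | rfl | rfl | rfl | rfl | rfl | rfl | rfl | rfl | rfl | rfl | rfl | rfl | rfl | rfl <;>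
  rcases eq_label m with rfl | rfl | rfl | rfl | rfl | rfl <;>
  first
  | exact absurd hm (by decide)
  -- Three edges have values that are products in the opposite order to `commHom`: (z 2)⁻¹ z 0, (z
  -- 2)⁻¹ z 1 and (z 3)⁻¹ z 1. The commutation rules reorder them.
  | simp [commHom, weight, plusSupport, minusSupport, pairCode, c02.symm.inv_left.eq,
      c12.symm.inv_left.eq, c13.symm.inv_left.eq,
      h2_35, h3_04, h2_13, h4_12, h0_12, h0_25, h5_03, h4_03, h0_45, h3_14, h4_13, h2_01, h0_15,
      h1_25, h1_23, h1_34, h2_05, h1_02, h2_14, h1_24, h4_01, h4_23, h2_04, h2_03, h5_24, h5_12,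
      h4_05, h3_05, h3_12, h5_04, h3_45, h0_34, h5_34, h5_02, h4_35, h0_35, h0_14, h3_25, h1_04,
      h5_23, h1_05, h3_24, h2_34, h5_01, h2_15, h5_13, h4_02, h1_35, h0_24, h3_15, h5_14, h3_02,
      h1_45, h0_23, h4_15, h1_03, h4_25, h0_13, h2_45, h3_01]

end FanoFibre

/-! ### Group-valued cocycles up to gauge. -/

namespace AbstractSimplicialComplex.IsCocycle

variable {V G : Type*} [Group G] {K : AbstractSimplicialComplex V} {g : V → V → G}

lemma self (hg : K.IsCocycle g) (v : V) : g v v = 1 := by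
  have := hg {v} (K.singleton_mem v) v (by simp) v (by simp) v (by simp)
  simpa using this

lemma inv (hg : K.IsCocycle g) {s : Finset V} (hs : s ∈ K.faces) {u v : V} (hu : u ∈ s)
    (hv : v ∈ s) : (g u v)⁻¹ = g v u := by
  rw [inv_eq_iff_mul_eq_one, hg s hs u hu v hv u hu, hg.self]

end AbstractSimplicialComplex.IsCocycle

namespace FanoFibre

open Component AbstractSimplicialComplex

/-- The five basic integral cocycles of the dual complex. -/
noncomputable def basicCocycle : Component → Component → Fin 5 → ℤ
  | D _, D _ => 0
  | D m, B a => weight m a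
  | B a, D m => -weight m a
  | B a, B b => weight (exists_notMem_pair a b).choose b - weight (exists_notMem_pair a b).choose a

/-- By `weight_square` the chosen label in the definition may be replaced by any other admissible
one. -/
lemma basicCocycle_B_B {a b : KSubset 6 2} (hab : Disjoint a.1 b.1) {m : Fin 6} (ha : m ∉ a.1)
    (hb : m ∉ b.1) : basicCocycle (B a) (B b) = weight m b - weight m a := by
  have h := (exists_notMem_pair a b).choose_spec
  ext i
  exact weight_square a b hab _ h.1 h.2 m ha hb i

lemma basicCocycle_add {s : Finset Component} (hs : s ∈ dualComplex.faces) {u v w : Component}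
    (hu : u ∈ s) (hv : v ∈ s) (hw : w ∈ s) :
    basicCocycle u v + basicCocycle v w = basicCocycle u w := by
  obtain ⟨m, a, b, hab, ha, hb, hs⟩ := exists_facet hs
  have h1 := basicCocycle_B_B hab ha hb
  have h2 := basicCocycle_B_B hab.symm hb ha
  have h3 : ∀ a, basicCocycle (B a) (B a) = 0 := fun a => sub_self _
  have h4 : ∀ m a, basicCocycle (D m) (B a) = weight m a := fun _ _ => rfl
  have h5 : ∀ m a, basicCocycle (B a) (D m) = -weight m a := fun _ _ => rfl
  have h6 : ∀ m, basicCocycle (D m) (D m) = 0 := fun _ => rfl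
  replace hu := hs hu
  replace hv := hs hv
  replace hw := hs hw
  simp only [Finset.mem_insert, Finset.mem_singleton] at hu hv hw
  rcases hu with rfl | rfl | rfl <;> rcases hv with rfl | rfl | rfl <;>
    rcases hw with rfl | rfl | rfl <;> simp only [h1, h2, h3, h4, h5, h6] <;> abel

/-- The vertex `D(m)` through which `B(a)` is joined to the root of the spanning tree. -/
def parent (a : KSubset 6 2) : Fin 6 :=
  if pairCode a ∈ [6, 36, 48, 34] then 0 else if pairCode a ∈ [12, 24, 5, 20] then 1
  else if pairCode a ∈ [40, 18, 3, 33] then 2 else if pairCode a = 17 then 3 else 4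

/-- Up to a gauge transformation, every cocycle comes from the five basic ones. -/
theorem exists_gauge {G : Type*} [Group G] {g : Component → Component → G}
    (hg : dualComplex.IsCocycle g) :
    ∃ (Z : Multiplicative (Fin 5 → ℤ) →* G) (p : Component → G),
      ∀ s ∈ dualComplex.faces, ∀ v ∈ s, ∀ w ∈ s,
        g v w = (p v)⁻¹ * Z (Multiplicative.ofAdd (basicCocycle v w)) * p w := by
  have hDB : ∀ m a, m ∉ a.1 → {D m, B a} ∈ dualComplex.faces := fun m a h =>
    (disjoint_label_iff.mp (disjoint_label_D_B.mpr h)).2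
  have inv1 : ∀ m a, m ∉ a.1 → (g (D m) (B a))⁻¹ = g (B a) (D m) := fun m a h =>
    hg.inv (hDB m a h) (by simp) (by simp)
  -- The elements q are the transports of g from the root D(0) to the other D's along the tree: D(4)
  -- and D(1) hang below D(0), D(2) and D(5) below D(4), and D(3) below D(2). The element r
  -- continues the transport to B(a) through its parent.
  let q4 : G := g (D 0) (B (pair 1 2)) * (g (D 4) (B (pair 1 2)))⁻¹
  let q2 : G := q4 * g (D 4) (B (pair 1 3)) * (g (D 2) (B (pair 1 3)))⁻¹
  let q1 : G := g (D 0) (B (pair 2 5)) * (g (D 1) (B (pair 2 5)))⁻¹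
  let q5 : G := q4 * g (D 4) (B (pair 0 3)) * (g (D 5) (B (pair 0 3)))⁻¹
  let q3 : G := q2 * g (D 2) (B (pair 1 4)) * (g (D 3) (B (pair 1 4)))⁻¹
  let q : Fin 6 → G := ![1, q1, q2, q3, q4, q5]
  let r : KSubset 6 2 → G := fun a => q (parent a) * g (D (parent a)) (B a)
  let h : Fin 6 → KSubset 6 2 → G := fun m a => q m * g (D m) (B a) * (r a)⁻¹
  have tree : ∀ m a, parent a = m → h m a = 1 := by
    rintro _ a rfl
    exact mul_inv_cancel _
  obtain ⟨Z, hZ⟩ := exists_hom_of_square h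
    -- The two triangles on the edge from B(a) to B(b) both involve g (B a) (B b); eliminating it
    -- yields the square relation.
    (fun a b m n hab ma mb na nb => by
      have e : ∀ k, k ∉ a.1 → k ∉ b.1 → g (D k) (B a) * g (B a) (B b) = g (D k) (B b) :=
        fun k ka kb => hg _ (facet_mem_faces hab ka kb) _ (by simp) _ (by simp) _ (by simp)
      simp only [h, ← e m ma mb, ← e n na nb]
      group)
    -- Fifteen tree edges join a B to its parent and are trivial by `tree`. The five handled by
    -- `simp` join a B to a child D and are trivial by the choice of q.
    (tree _ _ rfl) (tree _ _ rfl) (by simp [h, r, q, q2, show parent (pair 1 3) = 4 from rfl])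
    (by simp [h, r, q, q4, show parent (pair 1 2) = 0 from rfl]) (tree _ _ rfl) (tree _ _ rfl)
    (by simp [h, r, q, q5, show parent (pair 0 3) = 4 from rfl]) (tree _ _ rfl) (tree _ _ rfl)
    (by simp [h, r, q, q3, show parent (pair 1 4) = 2 from rfl]) (tree _ _ rfl) (tree _ _ rfl) (tree _ _ rfl)
    (by simp [h, r, q, q1, show parent (pair 2 5) = 0 from rfl]) (tree _ _ rfl) (tree _ _ rfl) (tree _ _ rfl)
    (tree _ _ rfl) (tree _ _ rfl) (tree _ _ rfl)
  have main : ∀ m a, m ∉ a.1 →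
      g (D m) (B a) = (q m)⁻¹ * Z (Multiplicative.ofAdd (weight m a)) * r a := by
    intro m a hm
    rw [← hZ m a hm]
    simp only [h]
    group
  let p : Component → G := fun c => match c with
    | D m => q m
    | B a => r a
  have pD : ∀ m, p (D m) = q m := fun _ => rfl
  have pB : ∀ a, p (B a) = r a := fun _ => rfl
  have e1 : ∀ m a, basicCocycle (D m) (B a) = weight m a := fun _ _ => rfl
  have e2 : ∀ m, basicCocycle (D m) (D m) = 0 := fun _ => rfl
  refine ⟨Z, p, fun s hs v hv w hw => ?_⟩
  obtain ⟨m, a, b, hab, ha, hb, hs⟩ := exists_facet hs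
  have hF := facet_mem_faces hab ha hb
  -- Inside a triangle it suffices to treat edges leaving D(m): a general value is a quotient of two
  -- of these.
  have base : ∀ c ∈ ({D m, B a, B b} : Finset Component),
      g (D m) c = (p (D m))⁻¹ * Z (Multiplicative.ofAdd (basicCocycle (D m) c)) * p c := by
    intro c hc
    simp only [Finset.mem_insert, Finset.mem_singleton] at hc
    rcases hc with rfl | rfl | rfl
    · simp [hg.self, e2]
    · exact main m a ha
    · exact main m b hb
  have hD : D m ∈ ({D m, B a, B b} : Finset Component) := by simp
  rw [← hg _ hF v (hs hv) _ hD w (hs hw), ← hg.inv hF hD (hs hv), base v (hs hv), base w (hs hw),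
    show basicCocycle v w = -basicCocycle (D m) v + basicCocycle (D m) w by
      rw [← basicCocycle_add hF hD (hs hv) (hs hw)]; abel, ofAdd_add, ofAdd_neg, map_mul, map_inv]
  group

end FanoFibre

/-! ### Winding of circle-valued functions along paths. -/

open scoped unitInterval

section Winding

variable {X : Type*} [TopologicalSpace X] (f : C(X, AddCircle (1 : ℝ)))

lemma exists_lift_path {x y : X} (γ : Path x y) :
    ∃ Γ : C(I, ℝ), ∀ t, (Γ t : AddCircle (1 : ℝ)) = f (γ t) := by
  obtain ⟨e, he⟩ := QuotientAddGroup.mk_surjective (f (γ 0))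
  obtain ⟨Γ, hΓ, -⟩ := (AddCircle.isCoveringMap_coe (1 : ℝ)).exists_path_lifts
    (f.comp γ.toContinuousMap) e he.symm
  exact ⟨Γ, fun t => congrFun hΓ t⟩

lemma sub_eq_of_homotopic {x y : X} {γ γ' : Path x y} (h : γ.Homotopic γ') {Γ Γ' : C(I, ℝ)}
    (hΓ : ∀ t, (Γ t : AddCircle (1 : ℝ)) = f (γ t))
    (hΓ' : ∀ t, (Γ' t : AddCircle (1 : ℝ)) = f (γ' t)) : Γ 1 - Γ 0 = Γ' 1 - Γ' 0 := by
  have cov := AddCircle.isCoveringMap_coe (1 : ℝ)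
  have h0 : (f.comp γ.toContinuousMap) 0 = ((Γ 0 : ℝ) : AddCircle (1 : ℝ)) := (hΓ 0).symm
  have h0' : (f.comp γ'.toContinuousMap) 0 = ((Γ 0 : ℝ) : AddCircle (1 : ℝ)) := by
    rw [hΓ]; simp
  have e1 : Γ = cov.liftPath (f.comp γ.toContinuousMap) (Γ 0) h0 :=
    (cov.eq_liftPath_iff' h0).mpr ⟨funext hΓ, rfl⟩
  -- The two lifts may start at different points of the fibre; translating the second makes the
  -- starting points agree, so that homotopy lifting applies.
  have e2 : Γ' + ContinuousMap.const _ (Γ 0 - Γ' 0) =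
      cov.liftPath (f.comp γ'.toContinuousMap) (Γ 0) h0' := by
    refine (cov.eq_liftPath_iff' h0').mpr ⟨funext fun t => ?_, by simp⟩
    have : (Γ 0 : AddCircle (1 : ℝ)) = (Γ' 0 : ℝ) := by rw [hΓ, hΓ']; simp
    simp [hΓ', this]
  have hf : (f.comp γ.toContinuousMap).HomotopicRel (f.comp γ'.toContinuousMap) {0, 1} :=
    ⟨ContinuousMap.HomotopyRel.compContinuousMap (Nonempty.some h) f⟩
  have key := cov.liftPath_apply_one_eq_of_homotopicRel hf (Γ 0) h0 h0'
  rw [← e1, ← e2] at key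
  simp only [ContinuousMap.add_apply, ContinuousMap.const_apply] at key
  linarith

/-- The total variation of the argument of a circle-valued function along a path. -/
noncomputable def winding {x y : X} (γ : Path.Homotopic.Quotient x y) : ℝ :=
  Quotient.lift (fun γ : Path x y =>
    (exists_lift_path f γ).choose 1 - (exists_lift_path f γ).choose 0)
    (fun γ γ' h => sub_eq_of_homotopic f h (exists_lift_path f γ).choose_spec
      (exists_lift_path f γ').choose_spec) γ

lemma winding_mk {x y : X} (γ : Path x y) (Γ : C(I, ℝ))
    (hΓ : ∀ t, (Γ t : AddCircle (1 : ℝ)) = f (γ t)) :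
    winding f (.mk γ) = Γ 1 - Γ 0 :=
  sub_eq_of_homotopic f (.refl γ) (exists_lift_path f γ).choose_spec hΓ

lemma winding_trans {x y z : X} (γ : Path.Homotopic.Quotient x y)
    (δ : Path.Homotopic.Quotient y z) : winding f (γ.trans δ) = winding f γ + winding f δ := by
  induction γ using Path.Homotopic.Quotient.ind with | mk γ =>
  induction δ using Path.Homotopic.Quotient.ind with | mk δ =>
  obtain ⟨Γ, hΓ⟩ := exists_lift_path f γ
  obtain ⟨Δ, hΔ⟩ := exists_lift_path f δ
  let P : Path (Γ 0) (Γ 1) := ⟨Γ, rfl, rfl⟩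
  -- Γ 1 and Δ 0 lie over the same point, so the translate of Δ is still a lift, and it can be
  -- concatenated with Γ.
  let Q : Path (Γ 1) (Δ 1 + (Γ 1 - Δ 0)) := ⟨Δ + ContinuousMap.const _ (Γ 1 - Δ 0), by simp, by simp⟩
  have h1 : ((Γ 1 : ℝ) : AddCircle (1 : ℝ)) = (Δ 0 : ℝ) := by rw [hΓ, hΔ]; simp
  rw [← Path.Homotopic.Quotient.mk_trans, winding_mk f γ Γ hΓ, winding_mk f δ Δ hΔ,
    winding_mk f _ (P.trans Q).toContinuousMap]
  · simp only [Path.coe_toContinuousMap, Path.source, Path.target]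
    ring
  · intro t
    rw [Path.coe_toContinuousMap, Path.trans_apply, Path.trans_apply]
    split_ifs
    · exact hΓ _
    · rw [← hΔ]
      change ((Δ _ + (Γ 1 - Δ 0) : ℝ) : AddCircle (1 : ℝ)) = _
      simp [h1]

lemma winding_refl (x : X) : winding f (.refl x) = 0 := by
  have := winding_trans f (.refl x) (.refl x)
  simpa using this

lemma winding_symm {x y : X} (γ : Path.Homotopic.Quotient x y) :
    winding f γ.symm = -winding f γ := by
  have := winding_trans f γ γ.symm
  rw [Path.Homotopic.Quotient.trans_symm, winding_refl] at this
  linarith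

lemma winding_of_mem {x y : X} (γ : Path x y) {U : Set X} (hγ : ∀ t, γ t ∈ U) {F : X → ℝ}
    (hF : Continuous F) (hf : ∀ x ∈ U, f x = (F x : AddCircle (1 : ℝ))) :
    winding f (.mk γ) = F y - F x := by
  rw [winding_mk f γ ⟨F ∘ γ, hF.comp γ.continuous⟩ fun t => (hf _ (hγ t)).symm]
  simp

/-- Real functions on the members of an open cover that differ by integers on the overlaps are the
local lifts of a circle-valued function. -/
lemma exists_circle_map {ι : Type*} {U : ι → Set X} (hU : ∀ i, IsOpen (U i))
    (hcov : ∀ x, ∃ i, x ∈ U i) {F : ι → X → ℝ} (hF : ∀ i, Continuous (F i))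
    (hint : ∀ i j x, x ∈ U i → x ∈ U j → ∃ n : ℤ, F i x - F j x = n) :
    ∃ f : C(X, AddCircle (1 : ℝ)), ∀ i, ∀ x ∈ U i, f x = (F i x : AddCircle (1 : ℝ)) := by
  choose c hc using hcov
  have key : ∀ i, ∀ x ∈ U i, ((F (c x) x : ℝ) : AddCircle (1 : ℝ)) = (F i x : ℝ) := by
    intro i x hx
    obtain ⟨n, hn⟩ := hint (c x) i x (hc x) hx
    rw [← sub_eq_zero, ← AddCircle.coe_sub, hn, AddCircle.coe_eq_zero_iff]
    exact ⟨n, by simp⟩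
  refine ⟨⟨fun x => (F (c x) x : ℝ), continuous_iff_continuousAt.mpr fun x => ?_⟩, key⟩
  have h1 : ContinuousAt (fun y => ((F (c x) y : ℝ) : AddCircle (1 : ℝ))) x :=
    ((AddCircle.continuous_mk' (1 : ℝ)).comp (hF (c x))).continuousAt
  refine h1.congr ?_
  filter_upwards [(hU (c x)).mem_nhds (hc x)] with y hy using (key _ y hy).symm

end Winding

/-! ### Path classes generated by the edges of a good cover. -/

open scoped unitInterval

/-- An open cover by path connected sets in which paths are determined by their end points up to
homotopy, with path connected pairwise intersections. -/
structure GoodCover (ι X : Type*) [TopologicalSpace X] where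
  /-- The members of the cover. -/
  set : ι → Set X
  isOpen : ∀ i, IsOpen (set i)
  exists_mem : ∀ x, ∃ i, x ∈ set i
  isPathConnected : ∀ i, IsPathConnected (set i)
  homotopic : ∀ i x y (p q : Path x y), (∀ t, p t ∈ set i) → (∀ t, q t ∈ set i) → p.Homotopic q
  inter : ∀ i j, (set i ∩ set j).Nonempty → IsPathConnected (set i ∩ set j)
  /-- A base point in each member. -/
  center : ι → X
  center_mem : ∀ i, center i ∈ set i

namespace GoodCover

variable {ι X : Type*} [TopologicalSpace X] (U : GoodCover ι X)

/-- The homotopy class of the paths from `x` to `y` inside a member of the cover. -/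
noncomputable def arc (i : ι) {x y : X} (hx : x ∈ U.set i) (hy : y ∈ U.set i) : Path.Homotopic.Quotient x y :=
  .mk ((U.isPathConnected i).joinedIn x hx y hy).somePath

lemma mk_eq_arc {i : ι} {x y : X} (p : Path x y) (hp : ∀ t, p t ∈ U.set i) (hx : x ∈ U.set i)
    (hy : y ∈ U.set i) : Path.Homotopic.Quotient.mk p = U.arc i hx hy :=
  Path.Homotopic.Quotient.eq.mpr (U.homotopic i x y _ _ hp (JoinedIn.somePath_mem _))

lemma arc_trans {i : ι} {x y z : X} (hx : x ∈ U.set i) (hy : y ∈ U.set i) (hz : z ∈ U.set i) :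
    (U.arc i hx hy).trans (U.arc i hy hz) = U.arc i hx hz := by
  rw [arc, arc, ← Path.Homotopic.Quotient.mk_trans]
  refine U.mk_eq_arc _ (fun t => ?_) hx hz
  rw [Path.trans_apply]
  split_ifs <;> exact JoinedIn.somePath_mem _ _

lemma arc_self {i : ι} {x : X} (hx : x ∈ U.set i) : U.arc i hx hx = .refl x :=
  (U.mk_eq_arc (Path.refl x) (fun _ => hx) hx hx).symm

/-- A path inside the connected intersection represents both arcs. -/
lemma arc_congr {i j : ι} {x y : X} (hx : x ∈ U.set i) (hy : y ∈ U.set i) (hx' : x ∈ U.set j)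
    (hy' : y ∈ U.set j) : U.arc i hx hy = U.arc j hx' hy' := by
  have h := (U.inter i j ⟨x, hx, hx'⟩).joinedIn x ⟨hx, hx'⟩ y ⟨hy, hy'⟩
  rw [← U.mk_eq_arc h.somePath (fun t => (h.somePath_mem t).1) hx hy,
    U.mk_eq_arc h.somePath (fun t => (h.somePath_mem t).2) hx' hy']

/-- The homotopy class of the paths from a center to another through a common point. -/
noncomputable def edge (i j : ι) {x : X} (hi : x ∈ U.set i) (hj : x ∈ U.set j) :
    Path.Homotopic.Quotient (U.center i) (U.center j) :=
  (U.arc i (U.center_mem i) hi).trans (U.arc j hj (U.center_mem j))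

lemma edge_congr {i j : ι} {x y : X} (hi : x ∈ U.set i) (hj : x ∈ U.set j) (hi' : y ∈ U.set i)
    (hj' : y ∈ U.set j) : U.edge i j hi hj = U.edge i j hi' hj' := by
  rw [edge, edge, ← U.arc_trans (U.center_mem i) hi hi', ← U.arc_trans hj' hj (U.center_mem j),
    U.arc_congr hj' hj hi' hi, Path.Homotopic.Quotient.trans_assoc,
    ← Path.Homotopic.Quotient.trans_assoc (U.arc i hi hi'), U.arc_trans, U.arc_self,
    Path.Homotopic.Quotient.refl_trans]

lemma edge_trans {i j k : ι} {x : X} (hi : x ∈ U.set i) (hj : x ∈ U.set j) (hk : x ∈ U.set k) :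
    (U.edge i j hi hj).trans (U.edge j k hj hk) = U.edge i k hi hk := by
  rw [edge, edge, edge, Path.Homotopic.Quotient.trans_assoc,
    ← Path.Homotopic.Quotient.trans_assoc (U.arc j hj _), U.arc_trans, U.arc_self,
    Path.Homotopic.Quotient.refl_trans]

/-- Every path is, up to homotopy, a composition of edges, preceded and followed by arcs. -/
lemma path_induction (R : ∀ i j, Path.Homotopic.Quotient (U.center i) (U.center j) → Prop)
    (hedge : ∀ i j x (hi : x ∈ U.set i) (hj : x ∈ U.set j), R i j (U.edge i j hi hj))
    (htrans : ∀ i j k f g, R i j f → R j k g → R i k (f.trans g))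
    {x y : X} (γ : Path.Homotopic.Quotient x y) {i j : ι} (hi : x ∈ U.set i) (hj : y ∈ U.set j) :
    R i j (((U.arc i (U.center_mem i) hi).trans γ).trans (U.arc j hj (U.center_mem j))) := by
  induction γ using Path.Homotopic.Quotient.ind with | mk γ =>
  obtain ⟨t, t0, tmono, ⟨N, hN⟩, ht⟩ := exists_monotone_Icc_subset_open_cover_unitInterval
    (c := fun k => γ ⁻¹' U.set k) (fun k => (U.isOpen k).preimage γ.continuous)
    (fun s _ => Set.mem_iUnion.mpr (U.exists_mem (γ s)))
  have h0 : γ 0 ∈ U.set i := by simpa using hi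
  -- Induction along a subdivision of [0, 1] whose pieces each map into one member of the cover.
  -- Letting k be any member containing the current end point allows a change of member at every
  -- subdivision point.
  have key : ∀ n k (hk : γ (t n) ∈ U.set k),
      R i k (((U.arc i (U.center_mem i) h0).trans (.mk (γ.subpath 0 (t n)))).trans
        (U.arc k hk (U.center_mem k))) := by
    intro n
    induction n with
    | zero =>
      rw [t0]
      intro k hk
      rw [Path.subpath_self, Path.Homotopic.Quotient.mk_refl,
        Path.Homotopic.Quotient.trans_refl]
      exact hedge i k _ h0 hk
    | succ n ih =>
      intro k hk
      obtain ⟨l, hl⟩ := ht n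
      have h1 : γ (t n) ∈ U.set l := hl ⟨le_rfl, tmono n.le_succ⟩
      have h2 : γ (t (n + 1)) ∈ U.set l := hl ⟨tmono n.le_succ, le_rfl⟩
      have e1 : Path.Homotopic.Quotient.mk (γ.subpath 0 (t (n + 1))) =
          (Path.Homotopic.Quotient.mk (γ.subpath 0 (t n))).trans (U.arc l h1 h2) := by
        rw [← U.mk_eq_arc (γ.subpath (t n) (t (n + 1))) _ h1 h2,
          ← Path.Homotopic.Quotient.mk_trans]
        · exact Path.Homotopic.Quotient.eq.mpr ⟨(Path.Homotopy.subpathTransSubpath γ _ _ _).symm⟩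
        · intro s
          have : γ.subpath (t n) (t (n + 1)) s ∈ γ '' Set.Icc (t n) (t (n + 1)) := by
            rw [← Path.range_subpath_of_le γ _ _ (tmono n.le_succ)]
            exact ⟨s, rfl⟩
          obtain ⟨r, hr, hr'⟩ := this
          exact hr' ▸ hl hr
      have := htrans _ _ _ _ _ (ih l h1) (hedge l k _ h2 hk)
      rw [edge, ← U.arc_trans h1 h2 (U.center_mem l)] at this
      rw [e1]
      simp only [Path.Homotopic.Quotient.trans_assoc] at this ⊢
      rwa [← Path.Homotopic.Quotient.trans_assoc (U.arc l h2 _), U.arc_trans, U.arc_self,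
        Path.Homotopic.Quotient.refl_trans] at this
  -- The end points γ 0 and γ 1 equal x and y only propositionally; generalising them disposes of
  -- the cast.
  have final : ∀ x' y' (hx : x' = x) (hy : y' = y) (hi' : x' ∈ U.set i) (hj' : y' ∈ U.set j),
      R i j (((U.arc i (U.center_mem i) hi').trans (.mk (γ.cast hx hy))).trans
        (U.arc j hj' (U.center_mem j))) →
      R i j (((U.arc i (U.center_mem i) hi).trans (.mk γ)).trans
        (U.arc j hj (U.center_mem j))) := by
    rintro _ _ rfl rfl hi' hj' h
    exact h
  have h1 : γ 1 ∈ U.set j := by simpa using hj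
  have hkey := key N
  rw [hN N le_rfl, Path.subpath_zero_one] at hkey
  exact final _ _ γ.source γ.target h0 h1 (hkey j h1)

section Loops

variable {x₀ : X} (p : ∀ i, Path.Homotopic.Quotient x₀ (U.center i))

/-- An edge, made into a loop by means of paths from the base point to the centers. The order is
such that composition of loops in the fundamental group follows the order of the indices. -/
noncomputable def loop (i j : ι) {x : X} (hi : x ∈ U.set i) (hj : x ∈ U.set j) :
    FundamentalGroup X x₀ :=
  ((p j).trans (U.edge j i hj hi)).trans (p i).symm

lemma loop_mul {i j k : ι} {x : X} (hi : x ∈ U.set i) (hj : x ∈ U.set j) (hk : x ∈ U.set k) :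
    U.loop p i j hi hj * U.loop p j k hj hk = U.loop p i k hi hk := by
  rw [FundamentalGroup.mul_def, loop, loop, loop, ← U.edge_trans hk hj hi]
  simp only [Path.Homotopic.Quotient.trans_assoc]
  rw [← Path.Homotopic.Quotient.trans_assoc (p j).symm, Path.Homotopic.Quotient.symm_trans,
    Path.Homotopic.Quotient.refl_trans]

end Loops

end GoodCover

/-! ### Open stars in the realization, and circle-valued functions from integral cocycles. -/

namespace AbstractSimplicialComplex

variable {V : Type*} [Fintype V] (K : AbstractSimplicialComplex V)

/-- The points of the realization whose support contains a given set of vertices. -/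
def openStar (s : Set V) : Set (V → ℝ) := {x | x ∈ K.realization ∧ ∀ v ∈ s, 0 < x v}

/-- The barycenter of a set of vertices. -/
noncomputable def barycenter [DecidableEq V] (s : Finset V) : V → ℝ :=
  fun v => if v ∈ s then (s.card : ℝ)⁻¹ else 0

lemma continuous_coord (v : V) : Continuous fun x : K.realization => x.1 v :=
  (continuous_apply v).comp continuous_subtype_val

variable {K}

lemma exists_face_of_mem_openStar {s : Set V} {x : V → ℝ} (hx : x ∈ K.openStar s) :
    ∃ t ∈ K.faces, s ⊆ t ∧ ∀ v, v ∉ t → x v = 0 := by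
  obtain ⟨⟨-, -, t, ht, h⟩, hs⟩ := hx
  exact ⟨t, ht, fun v hv => by_contra fun hvt => (hs v hv).ne' (h v hvt), h⟩

variable [DecidableEq V]

lemma barycenter_mem_openStar {s : Finset V} (hs : s ∈ K.faces) :
    barycenter s ∈ K.openStar (s : Set V) := by
  have hc : (0 : ℝ) < s.card := by
    exact_mod_cast Finset.card_pos.mpr (K.isRelLowerSet_faces hs).1
  refine ⟨⟨fun v => ?_, ?_, s, hs, fun v hv => by simp [barycenter, hv]⟩, fun v hv => ?_⟩
  · unfold barycenter; split_ifs <;> positivity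
  · simp [barycenter, hc.ne']
  · have : v ∈ s := hv
    simp [barycenter, this, hc]

/-- A point whose support contains s lies in a closed simplex that also contains the barycenter of
s, so the whole segment stays there. Connectedness and contractibility of open stars follow. -/
lemma starConvex_openStar (s : Finset V) (hs : s.Nonempty) :
    StarConvex ℝ (barycenter s) (K.openStar (s : Set V)) := by
  intro x hx a b ha hb hab
  obtain ⟨t, ht, hst, h⟩ := exists_face_of_mem_openStar hx
  have hbm : barycenter s ∈ K.openStar (s : Set V) :=
    barycenter_mem_openStar ((K.isRelLowerSet_faces ht).2 hst hs)
  refine ⟨⟨fun v => ?_, ?_, t, ht, fun v hv => ?_⟩, fun v hv => ?_⟩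
  · exact add_nonneg (mul_nonneg ha (hbm.1.1 v)) (mul_nonneg hb (hx.1.1 v))
  · simp [Finset.sum_add_distrib, ← Finset.mul_sum, hbm.1.2.1, hx.1.2.1, hab]
  · have : v ∉ s := fun hvs => hv (hst hvs)
    simp [h v hv, barycenter, this]
  · change 0 < a * barycenter s v + b * x v
    rcases ha.eq_or_lt with rfl | ha
    · have : b = 1 := by linarith
      simpa [this] using hx.2 v hv
    · exact add_pos_of_pos_of_nonneg (mul_pos ha (hbm.2 v hv)) (mul_nonneg hb (hx.1.1 v))

lemma isPathConnected_openStar {s : Finset V} (hs : s ∈ K.faces) :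
    IsPathConnected {x : K.realization | ∀ v ∈ s, 0 < x.1 v} := by
  rw [Topology.IsInducing.subtypeVal.isPathConnected_iff]
  have := (starConvex_openStar (K := K) s (K.isRelLowerSet_faces hs).1).isPathConnected
    (barycenter_mem_openStar hs)
  convert this using 1
  ext x
  simp [openStar, and_comm]

lemma homotopic_of_mem_openStar {s : Finset V} (hs : s ∈ K.faces) {x y : K.realization}
    (p q : Path x y) (hp : ∀ t, ∀ v ∈ s, 0 < (p t).1 v) (hq : ∀ t, ∀ v ∈ s, 0 < (q t).1 v) :
    p.Homotopic q := by
  have : ContractibleSpace (K.openStar (s : Set V)) :=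
    (starConvex_openStar (K := K) s (K.isRelLowerSet_faces hs).1).contractibleSpace
      ⟨_, barycenter_mem_openStar hs⟩
  let incl : C(K.openStar (s : Set V), K.realization) :=
    ⟨fun z => ⟨z.1, z.2.1⟩, by fun_prop⟩
  have hx : ∀ v ∈ s, 0 < x.1 v := by simpa using hp 0
  have hy : ∀ v ∈ s, 0 < y.1 v := by simpa using hp 1
  let lift (r : Path x y) (hr : ∀ t, ∀ v ∈ s, 0 < (r t).1 v) :
      Path (X := K.openStar (s : Set V)) ⟨x.1, x.2, hx⟩ ⟨y.1, y.2, hy⟩ :=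
    { toFun := fun t => ⟨(r t).1, (r t).2, hr t⟩
      continuous_toFun := by fun_prop
      source' := by simp
      target' := by simp }
  exact Path.Homotopic.map (SimplyConnectedSpace.paths_homotopic (lift p hp) (lift q hq)) incl

variable (K)

/-- The cover of the realization by the open stars of the vertices. -/
noncomputable def starCover : GoodCover V K.realization where
  set v := {x | 0 < x.1 v}
  isOpen v := isOpen_lt continuous_const (K.continuous_coord v)
  exists_mem x := by
    by_contra! h
    have h0 : ∀ v, x.1 v = 0 := fun v => le_antisymm (not_lt.mp (h v)) (x.2.1 v)
    have := x.2.2.1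
    simp [h0] at this
  isPathConnected v := by
    simpa using isPathConnected_openStar (K.singleton_mem v)
  homotopic v x y p q hp hq := by
    refine homotopic_of_mem_openStar (K.singleton_mem v) p q (fun t u hu => ?_) fun t u hu => ?_
    · exact Finset.mem_singleton.mp hu ▸ hp t
    · exact Finset.mem_singleton.mp hu ▸ hq t
  inter v w := by
    rintro ⟨x, hv, hw⟩
    obtain ⟨t, ht, hst, -⟩ := exists_face_of_mem_openStar (K := K) (s := {v, w}) (x := x.1)
      ⟨x.2, by rintro _ (rfl | rfl); exacts [hv, hw]⟩
    have hf : {v, w} ∈ K.faces := (K.isRelLowerSet_faces ht).2 (by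
      intro u hu
      exact hst (by simpa using hu)) (by simp)
    have := isPathConnected_openStar hf
    convert this using 1
    ext x
    simp
  center v := ⟨_, (barycenter_mem_openStar (K.singleton_mem v)).1⟩
  center_mem v := (barycenter_mem_openStar (K.singleton_mem v)).2 v (by simp)

variable {K}

/-- The barycenter of a face, as a point of the realization. -/
noncomputable def facePoint {s : Finset V} (hs : s ∈ K.faces) : K.realization :=
  ⟨_, (barycenter_mem_openStar hs).1⟩

lemma facePoint_mem {s : Finset V} (hs : s ∈ K.faces) {v : V} (hv : v ∈ s) :
    facePoint hs ∈ K.starCover.set v :=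
  (barycenter_mem_openStar hs).2 v hv

lemma exists_face_of_mem_starCover (x : K.realization) :
    ∃ t ∈ K.faces, (∀ v, x ∈ K.starCover.set v → v ∈ t) ∧ ∀ v, v ∉ t → x.1 v = 0 := by
  obtain ⟨t, ht, h⟩ := x.2.2.2
  exact ⟨t, ht, fun v hv => by_contra fun hvt => (ne_of_gt hv) (h v hvt), h⟩

section Cocycle

/-- The linear function on the star of `v` that is the lift of a cocycle. -/
noncomputable def localLift (c : V → V → ℤ) (v : V) (x : K.realization) : ℝ :=
  ∑ u, x.1 u * c v u

/-- On the face carrying x, the cocycle identity makes c v u - c w u equal to c v w for every vertex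
u, and barycentric coordinates sum to 1. -/
lemma localLift_sub {c : V → V → ℤ}
    (hc : ∀ s ∈ K.faces, ∀ u ∈ s, ∀ v ∈ s, ∀ w ∈ s, c u v + c v w = c u w) {v w : V}
    {x : K.realization} (hv : x ∈ K.starCover.set v) (hw : x ∈ K.starCover.set w) :
    localLift c v x - localLift c w x = c v w := by
  obtain ⟨t, ht, hmem, hzero⟩ := exists_face_of_mem_starCover x
  rw [localLift, localLift, ← Finset.sum_sub_distrib, ← one_mul (c v w : ℝ), ← x.2.2.1,
    Finset.sum_mul]
  refine Finset.sum_congr rfl fun u _ => ?_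
  by_cases hu : u ∈ t
  · rw [← hc t ht v (hmem v hv) w (hmem w hw) u hu]
    push_cast
    ring
  · simp [hzero u hu]

/-- An integral cocycle measures the winding of the edges for a circle-valued function. -/
lemma exists_winding_edge {c : V → V → ℤ}
    (hc : ∀ s ∈ K.faces, ∀ u ∈ s, ∀ v ∈ s, ∀ w ∈ s, c u v + c v w = c u w) :
    ∃ f : C(K.realization, AddCircle (1 : ℝ)), ∀ v w x (hv : x ∈ K.starCover.set v)
      (hw : x ∈ K.starCover.set w), winding f (K.starCover.edge v w hv hw) = c v w := by
  have hcont : ∀ v, Continuous (localLift (K := K) c v) := fun v =>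
    continuous_finsetSum _ fun u _ => (K.continuous_coord u).mul continuous_const
  obtain ⟨f, hf⟩ := exists_circle_map (U := K.starCover.set) K.starCover.isOpen
    K.starCover.exists_mem hcont fun v w x hv hw => ⟨c v w, localLift_sub hc hv hw⟩
  have hself : ∀ v, c v v = 0 := fun v => by
    have := hc {v} (K.singleton_mem v) v (by simp) v (by simp) v (by simp)
    omega
  -- Since lifts vanish at their own centers, the winding of an edge is just the difference of the
  -- two lifts at the crossing point.
  have hcenter : ∀ v, localLift c v (K.starCover.center v) = 0 := fun v => by
    refine Finset.sum_eq_zero fun u _ => ?_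
    by_cases hu : u = v
    · simp [hu, hself]
    · simp [starCover, barycenter, hu]
  refine ⟨f, fun v w x hv hw => ?_⟩
  rw [GoodCover.edge, winding_trans, GoodCover.arc, GoodCover.arc,
    winding_of_mem f _ (JoinedIn.somePath_mem _) (hcont v) (hf v),
    winding_of_mem f _ (JoinedIn.somePath_mem _) (hcont w) (hf w), hcenter, hcenter,
    ← localLift_sub hc hv hw]
  ring

end Cocycle

end AbstractSimplicialComplex

/-! ### Connectedness and the fundamental group. -/

namespace FanoFibre

open Component AbstractSimplicialComplex

lemma exists_notMem_of_labels (m n : Fin 6) : ∃ a : KSubset 6 2, m ∉ a.1 ∧ n ∉ a.1 := by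
  obtain ⟨a, -, ha⟩ := exists_disjoint_notMem (pair 0 1) m
  by_cases hn : n ∈ a.1
  · obtain ⟨b, hab, hb⟩ := exists_disjoint_notMem a m
    exact ⟨b, hb, Finset.disjoint_left.mp hab hn⟩
  · exact ⟨a, ha, hn⟩

lemma pair_mem_faces {m : Fin 6} {a : KSubset 6 2} (h : m ∉ a.1) :
    {D m, B a} ∈ dualComplex.faces :=
  (disjoint_label_iff.mp (disjoint_label_D_B.mpr h)).2

/-- The dual complex is connected. -/
lemma rel_of_equivalence {r : Component → Component → Prop} (hr : Equivalence r)
    (h : ∀ s ∈ dualComplex.faces, ∀ v ∈ s, ∀ w ∈ s, r v w) (v w : Component) : r v w := by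
  have hDB : ∀ m a, m ∉ a.1 → r (D m) (B a) := fun m a hm =>
    h _ (pair_mem_faces hm) _ (by simp) _ (by simp)
  have hDD : ∀ m n, r (D m) (D n) := fun m n => by
    obtain ⟨a, hm, hn⟩ := exists_notMem_of_labels m n
    exact hr.trans (hDB m a hm) (hr.symm (hDB n a hn))
  have hD : ∀ c, r (D 0) c := by
    rintro (m | a)
    · exact hDD 0 m
    · obtain ⟨m, hm, -⟩ := exists_notMem_pair a a
      exact hr.trans (hDD 0 m) (hDB m a hm)
  exact hr.trans (hr.symm (hD v)) (hD w)

/-- No nontrivial combination of the five basic cocycles is a coboundary. -/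
lemma eq_zero_of_coboundary {R : Type*} [CommRing R] {A : Fin 5 → R} {q : Component → R}
    (h : ∀ s ∈ dualComplex.faces, ∀ v ∈ s, ∀ w ∈ s,
      ∑ i, (basicCocycle v w i : R) * A i = q w - q v) : A = 0 := by
  have H : ∀ m a, m ∉ a.1 → ∑ i, (weight m a i : R) * A i = q (B a) - q (D m) := fun m a hm =>
    h _ (pair_mem_faces hm) (D m) (by simp) (B a) (by simp)
  -- The e-equations come from tree edges, where all weights vanish; each f-equation comes from a
  -- generator edge, where one weight is 1. Summing around the cycle that a generator edge closes in
  -- the tree cancels q and leaves one coordinate of A.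
  have e412 := H 4 (pair 1 2) (by decide)
  have e012 := H 0 (pair 1 2) (by decide)
  have e025 := H 0 (pair 2 5) (by decide)
  have e125 := H 1 (pair 2 5) (by decide)
  have e403 := H 4 (pair 0 3) (by decide)
  have e503 := H 5 (pair 0 3) (by decide)
  have e413 := H 4 (pair 1 3) (by decide)
  have e213 := H 2 (pair 1 3) (by decide)
  have e201 := H 2 (pair 0 1) (by decide)
  have e123 := H 1 (pair 2 3) (by decide)
  have e304 := H 3 (pair 0 4) (by decide)
  have e314 := H 3 (pair 1 4) (by decide)
  have e214 := H 2 (pair 1 4) (by decide)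
  have e124 := H 1 (pair 2 4) (by decide)
  have f0 := H 4 (pair 0 1) (by decide)
  have f1 := H 4 (pair 2 3) (by decide)
  have f2 := H 2 (pair 0 4) (by decide)
  have f3 := H 2 (pair 0 3) (by decide)
  have f4 := H 5 (pair 2 4) (by decide)
  simp [Fin.sum_univ_five, weight, pairCode, plusSupport, minusSupport] at e412 e012 e025 e125 e403
  simp [Fin.sum_univ_five, weight, pairCode, plusSupport, minusSupport] at e503 e413 e213 e201 e123
  simp [Fin.sum_univ_five, weight, pairCode, plusSupport, minusSupport] at e304 e314 e214 e124
  simp [Fin.sum_univ_five, weight, pairCode, plusSupport, minusSupport] at f0 f1 f2 f3 f4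
  ext i
  fin_cases i
  · simp only [Fin.zero_eta, Pi.zero_apply]
    linear_combination f0 - e201 + e213 - e413
  · simp only [Fin.mk_one, Pi.zero_apply]
    linear_combination f1 - e123 + e125 - e025 + e012 - e412
  · simp only [Fin.reduceFinMk, Pi.zero_apply]
    linear_combination f2 - e304 + e314 - e214
  · simp only [Fin.reduceFinMk, Pi.zero_apply]
    linear_combination f3 - e403 + e413 - e213
  · simp only [Fin.reduceFinMk, Pi.zero_apply]
    linear_combination f4 - e124 + e125 - e025 + e012 - e412 + e403 - e503

lemma basicCocycle_neg {s : Finset Component} (hs : s ∈ dualComplex.faces) {v w : Component}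
    (hv : v ∈ s) (hw : w ∈ s) : basicCocycle w v = -basicCocycle v w := by
  have h1 := basicCocycle_add hs hv hv hw
  have h2 := basicCocycle_add hs hv hw hv
  rw [add_eq_right] at h1
  rw [h1] at h2
  exact (neg_eq_of_add_eq_zero_right h2).symm

instance : PathConnectedSpace dualComplex.realization := by
  let U := dualComplex.starCover
  have key : ∀ v w, Joined (U.center v) (U.center w) :=
    rel_of_equivalence ⟨fun v => .refl _, fun h => h.symm, fun h h' => h.trans h'⟩
      fun s hs v hv w hw =>
        (((U.isPathConnected v).joinedIn _ (U.center_mem v) _ (facePoint_mem hs hv)).joined).trans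
          (((U.isPathConnected w).joinedIn _ (facePoint_mem hs hw) _ (U.center_mem w)).joined)
  refine ⟨⟨U.center (D 0)⟩, fun x y => ?_⟩
  obtain ⟨v, hv⟩ := U.exists_mem x
  obtain ⟨w, hw⟩ := U.exists_mem y
  exact (((U.isPathConnected v).joinedIn _ hv _ (U.center_mem v)).joined.trans (key v w)).trans
    ((U.isPathConnected w).joinedIn _ (U.center_mem w) _ hw).joined

lemma addMonoidHom_apply_eq_sum {n : ℕ} (φ : (Fin n → ℤ) →+ ℝ) (v : Fin n → ℤ) :
    φ v = ∑ i, (v i : ℝ) * φ (Pi.single i 1) := by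
  have := φ.toIntLinearMap.pi_apply_eq_sum_univ v
  have e : ∀ i : Fin n, (fun j => if i = j then (1 : ℤ) else 0) = Pi.single i 1 := fun i => by
    ext j
    simp [Pi.single_apply, eq_comm]
  simpa [e] using this

/-- Gauge reduction of the edge-loop cocycle gives a map from ℤ⁵; generation by edges makes it
surjective up to conjugation, and winding numbers make it injective. -/
theorem nonempty_fundamentalGroup_equiv (x : dualComplex.realization) :
    Nonempty (FundamentalGroup dualComplex.realization x ≃* Multiplicative (Fin 5 → ℤ)) := by
  classical
  let U := dualComplex.starCover
  let x₀ := U.center (D 0)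
  let p : ∀ v, Path.Homotopic.Quotient x₀ (U.center v) := fun v =>
    .mk (PathConnectedSpace.somePath x₀ (U.center v))
  -- The value 1 for disjoint stars is a filler: vertices of a common face have stars meeting at its
  -- barycenter.
  let g : Component → Component → FundamentalGroup dualComplex.realization x₀ := fun v w =>
    if h : ∃ x, x ∈ U.set v ∧ x ∈ U.set w then U.loop p v w h.choose_spec.1 h.choose_spec.2 else 1
  have g_eq : ∀ v w x (hv : x ∈ U.set v) (hw : x ∈ U.set w), g v w = U.loop p v w hv hw := by
    intro v w x hv hw
    simp only [g, dif_pos (⟨x, hv, hw⟩ : ∃ x, x ∈ U.set v ∧ x ∈ U.set w), GoodCover.loop]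
    rw [U.edge_congr]
  have hg : dualComplex.IsCocycle g := by
    intro s hs u hu v hv w hw
    rw [g_eq u v _ (facePoint_mem hs hu) (facePoint_mem hs hv),
      g_eq v w _ (facePoint_mem hs hv) (facePoint_mem hs hw),
      g_eq u w _ (facePoint_mem hs hu) (facePoint_mem hs hw), U.loop_mul]
  obtain ⟨Z, q, hZ⟩ := exists_gauge hg
  have hc : ∀ k, ∀ s ∈ dualComplex.faces, ∀ u ∈ s, ∀ v ∈ s, ∀ w ∈ s,
      basicCocycle u v k + basicCocycle v w k = basicCocycle u w k :=
    fun k s hs u hu v hv w hw => congrFun (basicCocycle_add hs hu hv hw) k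
  have hw := fun k => exists_winding_edge (K := dualComplex) (hc k)
  choose f hf using hw
  -- The sign arises because `GoodCover.loop` traverses the edge from w to v, so that products of
  -- loops follow the order of the indices.
  have hinj : ∀ n k, winding (f k) (Z (Multiplicative.ofAdd n)) = -n k := by
    intro n k
    let φ : (Fin 5 → ℤ) →+ ℝ :=
      { toFun := fun n => winding (f k) (Z (Multiplicative.ofAdd n))
        map_zero' := by rw [ofAdd_zero, map_one]; exact winding_refl _ _
        map_add' := fun a b => by
          rw [ofAdd_add, map_mul, FundamentalGroup.mul_def, winding_trans, add_comm] }
    -- Computing the winding of g v w directly and through the gauge formula shows that this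
    -- combination of basic cocycles is a coboundary over ℝ.
    have key : (fun i => φ (Pi.single i 1) + if i = k then 1 else 0) = 0 := by
      refine eq_zero_of_coboundary (q := fun v => winding (f k) (p v) - winding (f k) (q v))
        fun s hs v hv w hw => ?_
      have e1 : winding (f k) (g v w) =
          winding (f k) (p w) + basicCocycle w v k - winding (f k) (p v) := by
        rw [g_eq v w _ (facePoint_mem hs hv) (facePoint_mem hs hw), GoodCover.loop,
          winding_trans, winding_trans, winding_symm, hf]
        ring
      have e2 : winding (f k) (g v w) =
          winding (f k) (q w) + φ (basicCocycle v w) - winding (f k) (q v) := by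
        rw [hZ s hs v hv w hw, FundamentalGroup.mul_def, FundamentalGroup.mul_def,
          FundamentalGroup.inv_def, winding_trans, winding_trans, winding_symm]
        simp only [φ, AddMonoidHom.coe_mk, ZeroHom.coe_mk]
        ring
      rw [addMonoidHom_apply_eq_sum, e1, basicCocycle_neg hs hv hw] at e2
      simp only [mul_add, Finset.sum_add_distrib, mul_ite, mul_one, mul_zero,
        Finset.sum_ite_eq', Finset.mem_univ, if_true]
      simp only [Pi.neg_apply] at e2
      push_cast at e2
      linarith
    have hφ : ∀ i, φ (Pi.single i 1) = -if i = k then 1 else 0 := fun i =>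
      eq_neg_of_add_eq_zero_left (congrFun key i)
    change φ n = _
    rw [addMonoidHom_apply_eq_sum]
    simp [hφ]
  have key : ∀ {v w} (γ : Path.Homotopic.Quotient (U.center v) (U.center w)),
      ∃ n, FundamentalGroup.fromPath (((p v).trans γ).trans (p w).symm) =
        (q w)⁻¹ * Z n * q v := by
    intro v w γ
    have := U.path_induction (fun v w δ => ∃ n, FundamentalGroup.fromPath
        (((p v).trans δ).trans (p w).symm) = (q w)⁻¹ * Z n * q v) ?_ ?_ γ
      (U.center_mem v) (U.center_mem w)
    · rwa [U.arc_self, U.arc_self, Path.Homotopic.Quotient.refl_trans,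
        Path.Homotopic.Quotient.trans_refl] at this
    · intro v w y hv hw
      obtain ⟨t, ht, hmem, -⟩ := exists_face_of_mem_starCover y
      exact ⟨_, (g_eq w v y hw hv).symm.trans (hZ t ht w (hmem w hw) v (hmem v hv))⟩
    · rintro u v w δ ε ⟨n, hn⟩ ⟨m, hm⟩
      refine ⟨m * n, ?_⟩
      have e : FundamentalGroup.fromPath (((p u).trans (δ.trans ε)).trans (p w).symm) =
          FundamentalGroup.fromPath (((p v).trans ε).trans (p w).symm) *
            FundamentalGroup.fromPath (((p u).trans δ).trans (p v).symm) := by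
        rw [FundamentalGroup.mul_def]
        simp only [Path.Homotopic.Quotient.trans_assoc]
        rw [← Path.Homotopic.Quotient.trans_assoc (p v).symm,
          Path.Homotopic.Quotient.symm_trans, Path.Homotopic.Quotient.refl_trans]
      rw [e, hn, hm, map_mul]
      group
  -- The chosen path from the base point to the center of D(0) is a loop that need not be trivial;
  -- conjugation absorbs it together with the gauge factor.
  let P : FundamentalGroup dualComplex.realization x₀ := FundamentalGroup.fromPath (p (D 0))
  let ψ := (MulAut.conj (P * (q (D 0))⁻¹)).toMonoidHom.comp Z
  have hψ : Function.Bijective ψ := by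
    constructor
    · refine (MulAut.conj (P * (q (D 0))⁻¹)).injective.comp fun a b h => ?_
      change Z a = Z b at h
      have ha := hinj a.toAdd
      have hb := hinj b.toAdd
      simp only [ofAdd_toAdd] at ha hb
      rw [h] at ha
      refine Multiplicative.toAdd.injective (funext fun k => ?_)
      exact_mod_cast neg_injective ((ha k).symm.trans (hb k))
    · intro γ
      obtain ⟨n, hn⟩ := key (v := D 0) (w := D 0) γ
      have e : FundamentalGroup.fromPath (((p (D 0)).trans γ).trans (p (D 0)).symm) =
          P⁻¹ * (γ * P) := rfl
      refine ⟨n, ?_⟩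
      have hz : Z n = q (D 0) * (P⁻¹ * (γ * P)) * (q (D 0))⁻¹ := by
        rw [← e, hn]
        group
      simp only [ψ, MonoidHom.comp_apply, MulEquiv.coe_toMonoidHom, MulAut.conj_apply, hz]
      group
  exact ⟨(FundamentalGroup.fundamentalGroupMulEquivOfPathConnected x x₀).trans
    (MulEquiv.ofBijective ψ hψ).symm⟩

end FanoFibre

/-! ### Simplicial chains and cochains in low degree. -/

namespace AbstractSimplicialComplex

variable {V : Type*} {K : AbstractSimplicialComplex V}

/-- A vertex, as a `0`-simplex. -/
def vertexSimplex (K : AbstractSimplicialComplex V) (v : V) : K.Simplex 0 :=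
  ⟨{v}, K.singleton_mem v, rfl⟩

lemma exists_eq_vertexSimplex (s : K.Simplex 0) : ∃ v, s = K.vertexSimplex v := by
  obtain ⟨v, hv⟩ := Finset.card_eq_one.mp s.2.2
  exact ⟨v, Subtype.ext hv⟩

variable [LinearOrder V]

/-- The `1`-simplex with given vertices. -/
def edgeSimplex {v w : V} (h : v < w) (hf : {v, w} ∈ K.faces) : K.Simplex 1 :=
  ⟨{v, w}, hf, Finset.card_pair h.ne⟩

/-- The `2`-simplex with given vertices. -/
def triangleSimplex {u v w : V} (huv : u < v) (hvw : v < w) (hf : {u, v, w} ∈ K.faces) :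
    K.Simplex 2 :=
  ⟨{u, v, w}, hf, Finset.card_eq_three.mpr
    ⟨u, v, w, huv.ne, (huv.trans hvw).ne, hvw.ne, rfl⟩⟩

lemma exists_eq_edgeSimplex (s : K.Simplex 1) :
    ∃ (v w : V) (h : v < w) (hf : {v, w} ∈ K.faces), s = edgeSimplex h hf := by
  obtain ⟨v, w, hne, hs⟩ := Finset.card_eq_two.mp s.2.2
  have hf := s.2.1
  rcases lt_or_gt_of_ne hne with h | h
  · exact ⟨v, w, h, hs ▸ hf, Subtype.ext hs⟩
  · rw [Finset.pair_comm] at hs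
    exact ⟨w, v, h, hs ▸ hf, Subtype.ext hs⟩

lemma exists_eq_triangleSimplex (s : K.Simplex 2) :
    ∃ (u v w : V) (huv : u < v) (hvw : v < w) (hf : {u, v, w} ∈ K.faces),
      s = triangleSimplex huv hvw hf := by
  let i := s.1.orderEmbOfFin s.2.2
  have h01 : i 0 < i 1 := i.strictMono (by decide)
  have h12 : i 1 < i 2 := i.strictMono (by decide)
  have hs : {i 0, i 1, i 2} = s.1 := by
    refine Finset.eq_of_subset_of_card_le (fun x hx => ?_) ?_
    · simp only [Finset.mem_insert, Finset.mem_singleton] at hx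
      rcases hx with rfl | rfl | rfl <;> exact Finset.orderEmbOfFin_mem _ _ _
    · rw [s.2.2, Finset.card_eq_three.mpr
        ⟨i 0, i 1, i 2, h01.ne, (h01.trans h12).ne, h12.ne, rfl⟩]
  exact ⟨i 0, i 1, i 2, h01, h12, hs ▸ s.2.1, Subtype.ext hs.symm⟩

/-- Extending the summand to all of V removes the membership proofs, so the sum over an explicit
vertex set can be expanded. -/
lemma boundary_single_eq_sum {n : ℕ} (s : K.Simplex (n + 1)) (F : V → K.Chain n)
    (hF : ∀ v hv, Finsupp.single (s.facet v hv) ((-1 : ℚ) ^ position s.1 v) = F v) :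
    K.boundary n (Finsupp.single s 1) = ∑ v ∈ s.1, F v := by
  rw [boundary, Finsupp.linearCombination_single, one_smul]
  exact (Finset.sum_congr rfl fun v _ => hF v.1 v.2).trans (Finset.sum_attach s.1 F)

lemma boundary_edgeSimplex {v w : V} (h : v < w) (hf : {v, w} ∈ K.faces) :
    K.boundary 0 (Finsupp.single (edgeSimplex h hf) 1) =
      Finsupp.single (K.vertexSimplex w) 1 - Finsupp.single (K.vertexSimplex v) 1 := by
  rw [boundary_single_eq_sum _ fun x => if x = v then Finsupp.single (K.vertexSimplex w) 1 else
    -Finsupp.single (K.vertexSimplex v) 1]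
  · change ∑ x ∈ {v, w}, _ = _
    rw [Finset.sum_pair h.ne, if_pos rfl, if_neg h.ne']
    abel
  · intro x hx
    have hx' : x = v ∨ x = w := by simpa [edgeSimplex] using hx
    rcases hx' with rfl | rfl
    · have e1 : (edgeSimplex h hf).facet x hx = K.vertexSimplex w :=
        Subtype.ext (by simp [Simplex.facet, edgeSimplex, vertexSimplex, h.ne])
      have e2 : position (edgeSimplex h hf).1 x = 0 := by
        simp [position, edgeSimplex, Finset.filter_insert, Finset.filter_singleton, h.le]
      rw [e1, e2, if_pos rfl, pow_zero]
    · have e1 : (edgeSimplex h hf).facet x hx = K.vertexSimplex v :=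
        Subtype.ext (by
          simp [Simplex.facet, edgeSimplex, vertexSimplex, Finset.erase_insert_of_ne h.ne])
      have e2 : position (edgeSimplex h hf).1 x = 1 := by
        simp [position, edgeSimplex, Finset.filter_insert, Finset.filter_singleton, h]
      rw [e1, e2, if_neg h.ne', pow_one, Finsupp.single_neg]

lemma boundary_triangleSimplex {u v w : V} (huv : u < v) (hvw : v < w)
    (hf : {u, v, w} ∈ K.faces) (h1 : {u, v} ∈ K.faces) (h2 : {v, w} ∈ K.faces)
    (h3 : {u, w} ∈ K.faces) :
    K.boundary 1 (Finsupp.single (triangleSimplex huv hvw hf) 1) =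
      Finsupp.single (edgeSimplex huv h1) 1 + Finsupp.single (edgeSimplex hvw h2) 1 -
        Finsupp.single (edgeSimplex (huv.trans hvw) h3) 1 := by
  have huw := huv.trans hvw
  rw [boundary_single_eq_sum _ fun x => if x = u then Finsupp.single (edgeSimplex hvw h2) 1 else
    if x = v then -Finsupp.single (edgeSimplex huw h3) 1 else Finsupp.single (edgeSimplex huv h1) 1]
  · change ∑ x ∈ {u, v, w}, _ = _
    rw [Finset.sum_insert (by simp [huv.ne, huw.ne]), Finset.sum_pair hvw.ne, if_pos rfl,
      if_neg huv.ne', if_pos rfl, if_neg huw.ne', if_neg hvw.ne']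
    abel
  · intro x hx
    have hx' : x = u ∨ x = v ∨ x = w := by simpa [triangleSimplex] using hx
    rcases hx' with rfl | rfl | rfl
    · have e1 : (triangleSimplex huv hvw hf).facet x hx = edgeSimplex hvw h2 :=
        Subtype.ext (by simp [Simplex.facet, triangleSimplex, edgeSimplex, huv.ne, huw.ne])
      have e2 : position (triangleSimplex huv hvw hf).1 x = 0 := by
        simp [position, triangleSimplex, Finset.filter_insert, Finset.filter_singleton,
          huv.not_gt, huw.not_gt]
      rw [e1, e2, if_pos rfl, pow_zero]
    · have e1 : (triangleSimplex huv hvw hf).facet x hx = edgeSimplex huw h3 :=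
        Subtype.ext (by
          simp [Simplex.facet, triangleSimplex, edgeSimplex, Finset.erase_insert_of_ne huv.ne,
            hvw.ne])
      have e2 : position (triangleSimplex huv hvw hf).1 x = 1 := by
        simp [position, triangleSimplex, Finset.filter_insert, Finset.filter_singleton,
          huv, hvw.not_gt]
      rw [e1, e2, if_neg huv.ne', if_pos rfl, pow_one, Finsupp.single_neg]
    · have e1 : (triangleSimplex huv hvw hf).facet x hx = edgeSimplex huv h1 :=
        Subtype.ext (by
          simp [Simplex.facet, triangleSimplex, edgeSimplex, Finset.erase_insert_of_ne huw.ne,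
            Finset.erase_insert_of_ne hvw.ne])
      have e2 : position (triangleSimplex huv hvw hf).1 x = 2 := by
        simp [position, triangleSimplex, Finset.filter_insert, Finset.filter_singleton,
          huw, hvw, Finset.card_pair huv.ne]
      rw [e1, e2, if_neg huw.ne', if_neg hvw.ne']
      norm_num

section Cochains

variable {M : Type*} [AddCommGroup M] [Module ℚ M]

/-- The linear map on `0`-chains given by its values on the vertices. -/
noncomputable def vertexSum (K : AbstractSimplicialComplex V) (q : V → M) : K.Chain 0 →ₗ[ℚ] M :=
  Finsupp.linearCombination ℚ fun s : K.Simplex 0 =>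
    q (s.1.min' (Finset.card_pos.mp (by rw [s.2.2]; decide)))

/-- The linear map on `1`-chains given by its values on the oriented edges. -/
noncomputable def edgeSum (K : AbstractSimplicialComplex V) (c : V → V → M) : K.Chain 1 →ₗ[ℚ] M :=
  Finsupp.linearCombination ℚ fun s : K.Simplex 1 =>
    c (s.1.min' (Finset.card_pos.mp (by rw [s.2.2]; decide)))
      (s.1.max' (Finset.card_pos.mp (by rw [s.2.2]; decide)))

@[simp]
lemma vertexSum_single (q : V → M) (v : V) :
    K.vertexSum q (Finsupp.single (K.vertexSimplex v) 1) = q v := by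
  rw [vertexSum, Finsupp.linearCombination_single, one_smul]
  rfl

@[simp]
lemma edgeSum_single (c : V → V → M) {v w : V} (h : v < w) (hf : {v, w} ∈ K.faces) :
    K.edgeSum c (Finsupp.single (edgeSimplex h hf) 1) = c v w := by
  have h1 : ∀ hn, ({v, w} : Finset V).min' hn = v := fun hn =>
    le_antisymm (Finset.min'_le _ _ (by simp)) (by simp [h.le])
  have h2 : ∀ hn, ({v, w} : Finset V).max' hn = w := fun hn =>
    le_antisymm (by simp [h.le]) (Finset.le_max' _ _ (by simp))
  rw [edgeSum, Finsupp.linearCombination_single, one_smul]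
  exact congrArg₂ c (h1 _) (h2 _)

lemma chain_one_hom_ext {f g : K.Chain 1 →ₗ[ℚ] M}
    (h : ∀ v w (hvw : v < w) (hf : {v, w} ∈ K.faces),
      f (Finsupp.single (edgeSimplex hvw hf) 1) = g (Finsupp.single (edgeSimplex hvw hf) 1)) :
    f = g := by
  apply Finsupp.lhom_ext'
  intro s
  apply LinearMap.ext_ring
  obtain ⟨v, w, hvw, hf, rfl⟩ := exists_eq_edgeSimplex s
  exact h v w hvw hf

lemma edgeSum_comp_boundary {c : V → V → M}
    (hc : ∀ s ∈ K.faces, ∀ u ∈ s, ∀ v ∈ s, ∀ w ∈ s, c u v + c v w = c u w) :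
    K.edgeSum c ∘ₗ K.boundary 1 = 0 := by
  apply Finsupp.lhom_ext'
  intro s
  apply LinearMap.ext_ring
  obtain ⟨u, v, w, huv, hvw, hf, rfl⟩ := exists_eq_triangleSimplex s
  have sub : ∀ t : Finset V, t ⊆ {u, v, w} → t.Nonempty → t ∈ K.faces := fun t ht hn =>
    (K.isRelLowerSet_faces hf).2 ht hn
  simp only [LinearMap.comp_apply, Finsupp.lsingle_apply]
  rw [boundary_triangleSimplex huv hvw hf (sub _ (by intro; simp; tauto) (by simp))
    (sub _ (by intro; simp; tauto) (by simp)) (sub _ (by intro; simp; tauto) (by simp))]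
  simp [hc _ hf u (by simp) v (by simp) w (by simp)]

lemma edgeSum_coboundary (q : V → M) :
    K.edgeSum (fun v w => q w - q v) = K.vertexSum q ∘ₗ K.boundary 0 :=
  chain_one_hom_ext fun v w hvw hf => by simp [boundary_edgeSimplex]

end Cochains

section OrientedEdge

open Classical in
/-- The oriented edge from a vertex to another, as a chain. -/
noncomputable def orientedEdge (K : AbstractSimplicialComplex V) (v w : V) : K.Chain 1 :=
  if h : v < w ∧ {v, w} ∈ K.faces then Finsupp.single (edgeSimplex h.1 h.2) 1
  else if h : w < v ∧ {w, v} ∈ K.faces then -Finsupp.single (edgeSimplex h.1 h.2) 1 else 0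

lemma orientedEdge_of_lt {v w : V} (h : v < w) (hf : {v, w} ∈ K.faces) :
    K.orientedEdge v w = Finsupp.single (edgeSimplex h hf) 1 :=
  dif_pos ⟨h, hf⟩

lemma orientedEdge_self (v : V) : K.orientedEdge v v = 0 := by
  simp [orientedEdge]

lemma orientedEdge_swap (v w : V) : K.orientedEdge w v = -K.orientedEdge v w := by
  unfold orientedEdge
  by_cases h1 : v < w ∧ {v, w} ∈ K.faces
  · simp [h1, h1.1.not_gt]
  · by_cases h2 : w < v ∧ {w, v} ∈ K.faces
    · simp [h2, h2.1.not_gt]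
    · simp only [dif_neg h1, dif_neg h2, neg_zero]

/-- Antisymmetry reduces the cocycle identity for every ordering of the three vertices to the
increasing one, which is what the boundary of an oriented triangle provides. -/
lemma add_eq_of_sorted {A : Type*} [AddCommGroup A] {s : Finset V} {m : V → V → A}
    (self : ∀ v, m v v = 0) (swap : ∀ v w, m w v = -m v w)
    (sorted : ∀ u ∈ s, ∀ v ∈ s, ∀ w ∈ s, u < v → v < w → m u v + m v w = m u w)
    {u v w : V} (hu : u ∈ s) (hv : v ∈ s) (hw : w ∈ s) : m u v + m v w = m u w := by
  rcases lt_trichotomy u v with h1 | rfl | h1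
  · rcases lt_trichotomy v w with h2 | rfl | h2
    · exact sorted u hu v hv w hw h1 h2
    · simp [self]
    · rcases lt_trichotomy u w with h3 | rfl | h3
      · rw [← sorted u hu w hw v hv h3 h2, swap w v]; abel
      · rw [self, swap u v]; abel
      · rw [swap w v, swap w u, ← sorted w hw u hu v hv h3 h1]; abel
  · simp [self]
  · rcases lt_trichotomy v w with h2 | rfl | h2
    · rcases lt_trichotomy u w with h3 | rfl | h3
      · rw [swap v u, ← sorted v hv u hu w hw h1 h3]; abel
      · rw [self, swap v u]; abel
      · rw [swap v u, swap w u, ← sorted v hv w hw u hu h2 h3]; abel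
    · simp [self]
    · rw [swap v u, swap w v, swap w u, ← sorted w hw v hv u hu h2 h1]; abel

/-- The classes of the oriented edges modulo boundaries form a cocycle. -/
lemma isCocycle_orientedEdge : K.IsCocycle fun v w =>
    Multiplicative.ofAdd ((K.boundaries 1).mkQ (K.orientedEdge v w)) := by
  intro s hs u hu v hv w hw
  rw [← ofAdd_add]
  refine congrArg _ ?_
  have self : ∀ v, (K.boundaries 1).mkQ (K.orientedEdge v v) = 0 := fun v => by
    rw [orientedEdge_self, map_zero]
  have swap : ∀ v w, (K.boundaries 1).mkQ (K.orientedEdge w v) =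
      -(K.boundaries 1).mkQ (K.orientedEdge v w) := fun v w => by
    rw [orientedEdge_swap, map_neg]
  have sorted : ∀ u ∈ s, ∀ v ∈ s, ∀ w ∈ s, u < v → v < w →
      (K.boundaries 1).mkQ (K.orientedEdge u v) + (K.boundaries 1).mkQ (K.orientedEdge v w) =
        (K.boundaries 1).mkQ (K.orientedEdge u w) := by
    intro u hu v hv w hw huv hvw
    have sub : ∀ t : Finset V, t ⊆ s → t.Nonempty → t ∈ K.faces := fun t ht hn =>
      (K.isRelLowerSet_faces hs).2 ht hn
    have hf : {u, v, w} ∈ K.faces := sub _ (by intro; simp; rintro (rfl | rfl | rfl) <;>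
      assumption) (by simp)
    have h1 : {u, v} ∈ K.faces := sub _ (by intro; simp; rintro (rfl | rfl) <;>
      assumption) (by simp)
    have h2 : {v, w} ∈ K.faces := sub _ (by intro; simp; rintro (rfl | rfl) <;>
      assumption) (by simp)
    have h3 : {u, w} ∈ K.faces := sub _ (by intro; simp; rintro (rfl | rfl) <;>
      assumption) (by simp)
    rw [orientedEdge_of_lt huv h1, orientedEdge_of_lt hvw h2,
      orientedEdge_of_lt (huv.trans hvw) h3, ← sub_eq_zero, ← map_add, ← map_sub,
      ← boundary_triangleSimplex huv hvw hf, Submodule.mkQ_apply, Submodule.Quotient.mk_eq_zero]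
    exact ⟨_, rfl⟩
  exact add_eq_of_sorted (m := fun v w => (K.boundaries 1).mkQ (K.orientedEdge v w)) self swap
    sorted hu hv hw

end OrientedEdge

end AbstractSimplicialComplex

/-! ### The Betti numbers. -/

namespace FanoFibre

open Component AbstractSimplicialComplex

/-- The pairing of the `1`-chains with the five basic cocycles. -/
noncomputable def period : dualComplex.Chain 1 →ₗ[ℚ] (Fin 5 → ℚ) :=
  dualComplex.edgeSum fun v w i => (basicCocycle v w i : ℚ)

lemma period_comp_boundary : period ∘ₗ dualComplex.boundary 1 = 0 :=
  edgeSum_comp_boundary fun s hs u hu v hv w hw => by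
    ext i
    rw [← basicCocycle_add hs hu hv hw]
    simp

lemma mem_boundaries_of_period_eq_zero {x : dualComplex.Chain 1}
    (hx : dualComplex.boundary 0 x = 0) (hp : period x = 0) : x ∈ dualComplex.boundaries 1 := by
  obtain ⟨Z, p, hZ⟩ := exists_gauge (isCocycle_orientedEdge (K := dualComplex))
  let z : (Fin 5 → ℤ) →+ (dualComplex.Chain 1 ⧸ dualComplex.boundaries 1) := Z.toAdditiveRight
  let L : (Fin 5 → ℚ) →ₗ[ℚ] (dualComplex.Chain 1 ⧸ dualComplex.boundaries 1) :=
    Fintype.linearCombination ℚ fun i => z (Pi.single i 1)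
  have hL : ∀ n : Fin 5 → ℤ, z n = L fun i => (n i : ℚ) := fun n => by
    have := z.toIntLinearMap.pi_apply_eq_sum_univ n
    have e : ∀ i : Fin 5, (fun j => if i = j then (1 : ℤ) else 0) = Pi.single i 1 := fun i => by
      ext j
      simp [Pi.single_apply, eq_comm]
    simp only [AddMonoidHom.coe_toIntLinearMap, e] at this
    rw [this, Fintype.linearCombination_apply]
    exact Finset.sum_congr rfl fun i _ => (Int.cast_smul_eq_zsmul ℚ _ _).symm
  -- The gauge formula, in additive form and extended linearly: modulo boundaries, a chain depends
  -- only on its boundary and its periods.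
  have key : (dualComplex.boundaries 1).mkQ =
      dualComplex.vertexSum (fun v => (p v).toAdd) ∘ₗ dualComplex.boundary 0 + L ∘ₗ period := by
    refine chain_one_hom_ext fun v w hvw hf => ?_
    have h := congrArg Multiplicative.toAdd (hZ _ hf v (by simp) w (by simp))
    rw [← orientedEdge_of_lt hvw hf]
    refine h.trans ?_
    change -(p v).toAdd + z (basicCocycle v w) + (p w).toAdd = _
    rw [hL, orientedEdge_of_lt hvw hf]
    simp only [LinearMap.add_apply, LinearMap.comp_apply, boundary_edgeSimplex, map_sub,
      vertexSum_single, period, edgeSum_single]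
    abel
  have := LinearMap.congr_fun key x
  rwa [LinearMap.add_apply, LinearMap.comp_apply, LinearMap.comp_apply, hx, hp, map_zero, map_zero,
    add_zero, Submodule.mkQ_apply, Submodule.Quotient.mk_eq_zero] at this

/-- By duality: a functional that kills the periods of all cycles pulls back to a functional
factoring through the boundary map. It is thus a coboundary combination of basic cocycles, hence
zero by `eq_zero_of_coboundary`. -/
lemma period_surjective_on_cycles :
    Function.Surjective (period.domRestrict (LinearMap.ker (dualComplex.boundary 0))) := by
  rw [← LinearMap.range_eq_top]
  by_contra hne
  obtain ⟨f, hf, hker⟩ := Submodule.exists_dual_map_eq_bot_of_lt_top (lt_top_iff_ne_top.mpr hne)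
    inferInstance
  have hann : f ∘ₗ period ∈ (LinearMap.ker (dualComplex.boundary 0)).dualAnnihilator := by
    rw [Submodule.mem_dualAnnihilator]
    intro x hx
    have : f (period x) ∈ Submodule.map f (LinearMap.range
        (period.domRestrict (LinearMap.ker (dualComplex.boundary 0)))) :=
      Submodule.mem_map_of_mem ⟨⟨x, hx⟩, rfl⟩
    rw [hker] at this
    exact (Submodule.mem_bot ℚ).mp this
  rw [← LinearMap.range_dualMap_eq_dualAnnihilator_ker] at hann
  obtain ⟨ψ, hψ⟩ := hann
  have hval : ∀ n : Fin 5 → ℚ, f n = ∑ i, n i * f (Pi.single i 1) := fun n => by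
    have := f.pi_apply_eq_sum_univ n
    have e : ∀ i : Fin 5, (fun j => if i = j then (1 : ℚ) else 0) = Pi.single i 1 := fun i => by
      ext j
      simp [Pi.single_apply, eq_comm]
    simpa [e] using this
  have hlt : ∀ v w (hvw : v < w), {v, w} ∈ dualComplex.faces →
      ∑ i, (basicCocycle v w i : ℚ) * f (Pi.single i 1) =
        ψ (Finsupp.single (dualComplex.vertexSimplex w) 1) -
          ψ (Finsupp.single (dualComplex.vertexSimplex v) 1) := by
    intro v w hvw hf
    have := LinearMap.congr_fun hψ (Finsupp.single (edgeSimplex hvw hf) 1)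
    rw [LinearMap.dualMap_apply, boundary_edgeSimplex, map_sub, LinearMap.comp_apply, period,
      edgeSum_single, hval] at this
    exact this.symm
  have hzero : (fun i => f (Pi.single i 1)) = 0 := by
    refine eq_zero_of_coboundary (q := fun v => ψ (Finsupp.single (dualComplex.vertexSimplex v) 1))
      fun s hs v hv w hw => ?_
    have sub : ∀ t : Finset Component, t ⊆ s → t.Nonempty → t ∈ dualComplex.faces :=
      fun t ht hn => (dualComplex.isRelLowerSet_faces hs).2 ht hn
    rcases lt_trichotomy v w with h | rfl | h
    · exact hlt v w h (sub _ (by intro; simp; rintro (rfl | rfl) <;> assumption) (by simp))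
    · have : basicCocycle v v = 0 := by simpa using basicCocycle_add hs hv hv hv
      simp [this]
    · have := hlt w v h (sub _ (by intro; simp; rintro (rfl | rfl) <;> assumption) (by simp))
      rw [basicCocycle_neg hs hw hv, ← neg_sub, ← this]
      simp
  refine hf (LinearMap.ext fun n => ?_)
  rw [hval]
  simp [fun i => congrFun hzero i]

theorem betti_one : dualComplex.betti 1 = 5 := by
  let Φ := period.domRestrict (LinearMap.ker (dualComplex.boundary 0))
  have hker : LinearMap.ker Φ =
      (dualComplex.boundaries 1).submoduleOf (LinearMap.ker (dualComplex.boundary 0)) := by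
    ext ⟨x, hx⟩
    change _ ↔ x ∈ dualComplex.boundaries 1
    refine ⟨fun h => mem_boundaries_of_period_eq_zero hx h, ?_⟩
    rintro ⟨y, rfl⟩
    exact LinearMap.congr_fun period_comp_boundary y
  have e := (Submodule.quotEquivOfEq _ _ hker.symm).trans
    (Φ.quotKerEquivOfSurjective period_surjective_on_cycles)
  exact e.finrank_eq.trans (by simp)

lemma card_simplex_zero : Nat.card (dualComplex.Simplex 0) = 21 := by
  rw [← Nat.card_eq_of_bijective dualComplex.vertexSimplex ⟨fun v w h => ?_, fun s => ?_⟩,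
    Nat.card_eq_fintype_card]
  · decide +kernel
  · exact Finset.singleton_injective (congrArg Subtype.val h)
  · obtain ⟨v, rfl⟩ := exists_eq_vertexSimplex s
    exact ⟨v, rfl⟩

/-- The count is 60 edges D-B plus 45 edges B-B. -/
lemma card_simplex_one : Nat.card (dualComplex.Simplex 1) = 105 := by
  let E := {e : Component × Component // e.1 < e.2 ∧ Disjoint e.1.label.1 e.2.label.1}
  let φ : E → dualComplex.Simplex 1 := fun e =>
    edgeSimplex e.2.1 (disjoint_label_iff.mp e.2.2).2
  have hφ : Function.Bijective φ := by
    constructor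
    · rintro ⟨⟨v, w⟩, hvw, h⟩ ⟨⟨v', w'⟩, hvw', h'⟩ he
      have he : ({v, w} : Finset Component) = {v', w'} := congrArg Subtype.val he
      have hv : v ∈ ({v', w'} : Finset Component) := he ▸ by simp
      have hw : w ∈ ({v', w'} : Finset Component) := he ▸ by simp
      simp only [Finset.mem_insert, Finset.mem_singleton] at hv hw
      simp only at hvw hvw'
      rcases hv with rfl | rfl <;> rcases hw with rfl | rfl
      · exact absurd hvw (lt_irrefl _)
      · rfl
      · exact absurd hvw hvw'.not_gt
      · exact absurd hvw (lt_irrefl _)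
    · intro s
      obtain ⟨v, w, h, hf, rfl⟩ := exists_eq_edgeSimplex s
      exact ⟨⟨(v, w), h, disjoint_label_iff.mpr ⟨h.ne, hf⟩⟩, rfl⟩
  rw [← Nat.card_eq_of_bijective φ hφ, Nat.card_eq_fintype_card]
  decide +kernel

lemma card_simplex_two : Nat.card (dualComplex.Simplex 2) = 90 := by
  let T := {t : Fin 6 × KSubset 6 2 × KSubset 6 2 // B t.2.1 < B t.2.2 ∧
    Disjoint t.2.1.1 t.2.2.1 ∧ t.1 ∉ t.2.1.1 ∧ t.1 ∉ t.2.2.1}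
  let φ : T → dualComplex.Simplex 2 := fun t =>
    ⟨_, facet_mem_faces t.2.2.1 t.2.2.2.1 t.2.2.2.2,
      Finset.card_eq_three.mpr ⟨_, _, _, by simp, by simp, t.2.1.ne, rfl⟩⟩
  have hφ : Function.Bijective φ := by
    constructor
    · rintro ⟨⟨m, a, b⟩, hab, h⟩ ⟨⟨m', a', b'⟩, hab', h'⟩ he
      have he : ({D m, B a, B b} : Finset Component) = {D m', B a', B b'} :=
        congrArg Subtype.val he
      have hm : D m ∈ ({D m', B a', B b'} : Finset Component) := he ▸ by simp
      have ha : B a ∈ ({D m', B a', B b'} : Finset Component) := he ▸ by simp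
      have hb : B b ∈ ({D m', B a', B b'} : Finset Component) := he ▸ by simp
      simp at hm ha hb
      simp only at hab hab'
      subst hm
      rcases ha with rfl | rfl <;> rcases hb with rfl | rfl
      · exact absurd hab (lt_irrefl _)
      · rfl
      · exact absurd hab hab'.not_gt
      · exact absurd hab (lt_irrefl _)
    · intro s
      obtain ⟨m, a, b, hab, ha, hb, hs⟩ := exists_facet s.2.1
      have hs' := Finset.eq_of_subset_of_card_le hs (Finset.card_le_three.trans s.2.2.ge)
      have hne : (B a : Component) ≠ B b := fun h => by
        have := s.2.2
        rw [hs', h] at this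
        have := Finset.card_le_two (a := D m) (b := B b)
        simp_all
      rcases lt_or_gt_of_ne hne with h | h
      · exact ⟨⟨(m, a, b), h, hab, ha, hb⟩, Subtype.ext hs'.symm⟩
      · exact ⟨⟨(m, b, a), h, hab.symm, hb, ha⟩,
          Subtype.ext (by rw [hs', Finset.pair_comm (B a)])⟩
  rw [← Nat.card_eq_of_bijective φ hφ, Nat.card_eq_fintype_card]
  decide +kernel

lemma finrank_chain (n : ℕ) :
    Module.finrank ℚ (dualComplex.Chain n) = Nat.card (dualComplex.Simplex n) :=
  Module.finrank_eq_nat_card_basis Finsupp.basisSingleOne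

instance (n : ℕ) : Finite (dualComplex.Simplex n) :=
  Subtype.finite

/-- Connectedness identifies the image with the kernel of the augmentation, of dimension 21 - 1. -/
lemma finrank_range_boundary_zero :
    Module.finrank ℚ (LinearMap.range (dualComplex.boundary 0)) = 20 := by
  let ε : dualComplex.Chain 0 →ₗ[ℚ] ℚ := dualComplex.vertexSum fun _ => 1
  let R := LinearMap.range (dualComplex.boundary 0)
  let pt : Component → dualComplex.Chain 0 := fun v => Finsupp.single (dualComplex.vertexSimplex v) 1
  have hrel : ∀ v w, pt v - pt w ∈ R := by
    refine rel_of_equivalence ⟨fun v => by simp, fun h => ?_, fun h h' => ?_⟩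
      fun s hs v hv w hw => ?_
    · simpa using R.neg_mem h
    · simpa using R.add_mem h h'
    · have sub : ∀ t : Finset Component, t ⊆ s → t.Nonempty → t ∈ dualComplex.faces :=
        fun t ht hn => (dualComplex.isRelLowerSet_faces hs).2 ht hn
      rcases lt_trichotomy v w with h | rfl | h
      · have := boundary_edgeSimplex h
          (sub _ (by intro; simp; rintro (rfl | rfl) <;> assumption) (by simp))
        simpa [pt] using R.neg_mem ⟨_, this⟩
      · simp
      · exact ⟨_, boundary_edgeSimplex h
          (sub _ (by intro; simp; rintro (rfl | rfl) <;> assumption) (by simp))⟩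
  have hker : R = LinearMap.ker ε := by
    apply le_antisymm
    · have : ε ∘ₗ dualComplex.boundary 0 = 0 := by
        rw [← edgeSum_coboundary]
        exact chain_one_hom_ext fun v w h hf => by simp
      exact LinearMap.range_le_ker_iff.mpr this
    · intro x hx
      have key : R.mkQ = (LinearMap.toSpanSingleton ℚ _ (R.mkQ (pt (D 0)))) ∘ₗ ε := by
        apply Finsupp.lhom_ext'
        intro s
        apply LinearMap.ext_ring
        obtain ⟨v, rfl⟩ := exists_eq_vertexSimplex s
        simp only [LinearMap.comp_apply, Finsupp.lsingle_apply, ε, vertexSum_single,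
          LinearMap.toSpanSingleton_apply, one_smul]
        rw [← sub_eq_zero, ← map_sub, Submodule.mkQ_apply, Submodule.Quotient.mk_eq_zero]
        exact hrel v (D 0)
      have := LinearMap.congr_fun key x
      rwa [LinearMap.comp_apply, LinearMap.mem_ker.mp hx, map_zero, Submodule.mkQ_apply,
        Submodule.Quotient.mk_eq_zero] at this
  have hsurj : Function.Surjective ε := fun r => ⟨r • pt (D 0), by
    rw [map_smul, vertexSum_single, smul_eq_mul, mul_one]⟩
  have h1 := ε.finrank_range_add_finrank_ker
  rw [LinearMap.range_eq_top.mpr hsurj, finrank_top, Module.finrank_self, finrank_chain,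
    card_simplex_zero, ← hker] at h1
  change Module.finrank ℚ R = 20
  omega

/-- The 1-cycles have dimension 105 - 20 = 85, so the 1-boundaries have dimension 85 - 5 = 80 and
the 2-cycles 90 - 80 = 10. Without 3-simplices there are no 2-boundaries to divide out. -/
theorem betti_two : dualComplex.betti 2 = 10 := by
  have hle := dualComplex.boundaries_le_cycles 1
  have h0 := (dualComplex.boundary 0).finrank_range_add_finrank_ker
  have h1 := (dualComplex.boundary 1).finrank_range_add_finrank_ker
  rw [finrank_chain, card_simplex_one, finrank_range_boundary_zero] at h0
  rw [finrank_chain, card_simplex_two] at h1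
  have h2 : dualComplex.betti 1 + Module.finrank ℚ (LinearMap.range (dualComplex.boundary 1)) =
      Module.finrank ℚ (LinearMap.ker (dualComplex.boundary 0)) := by
    have := ((dualComplex.boundaries 1).submoduleOf
      (dualComplex.cycles 1)).finrank_quotient_add_finrank
    rwa [(Submodule.submoduleOfEquivOfLe hle).finrank_eq] at this
  rw [betti_one] at h2
  have hempty : IsEmpty (dualComplex.Simplex 3) :=
    ⟨fun s => absurd (card_le_three s.2.1) (by rw [s.2.2]; decide)⟩
  have hbot : (dualComplex.boundaries 2).submoduleOf (dualComplex.cycles 2) = ⊥ := by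
    have : dualComplex.boundaries 2 = ⊥ := by
      rw [boundaries, LinearMap.range_eq_bot]
      exact Subsingleton.elim _ _
    rw [this]
    exact Submodule.comap_bot _ |>.trans (Submodule.ker_subtype _)
  have e := Submodule.quotEquivOfEqBot _ hbot
  have h4 : dualComplex.betti 2 = Module.finrank ℚ (LinearMap.ker (dualComplex.boundary 1)) :=
    e.finrank_eq
  omega

end FanoFibre

theorem mainTheorem8 :
    -- the 1-skeleton is the Kneser graph, the label `7` marking the del Pezzo components
    (∃ φ : FanoFibre.dualComplex.oneSkeleton ≃g kneserGraph 7 2,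
      (∀ m : Fin 6, (φ (.D m)).1 = {m.castSucc, Fin.last 6}) ∧
      (∀ s : KSubset 6 2, (φ (.B s)).1 = s.1.map Fin.castSuccEmb) ∧
      -- the 2-faces are the triangles that have a vertex of type `{i, 7}`
      (∀ t : Finset FanoFibre.Component, t.card = 3 →
        (t ∈ FanoFibre.dualComplex.faces ↔
          (∀ v ∈ t, ∀ w ∈ t, v ≠ w → (kneserGraph 7 2).Adj (φ v) (φ w)) ∧
          ∃ v ∈ t, Fin.last 6 ∈ (φ v).1))) ∧
    -- there are no faces of higher dimension
    (∀ t ∈ FanoFibre.dualComplex.faces, t.card ≤ 3) ∧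
    PathConnectedSpace FanoFibre.dualComplex.realization ∧
    (∀ x : FanoFibre.dualComplex.realization,
      Nonempty (FundamentalGroup FanoFibre.dualComplex.realization x ≃*
        Multiplicative (Fin 5 → ℤ))) ∧
    FanoFibre.dualComplex.betti 1 = 5 ∧
    FanoFibre.dualComplex.betti 2 = 10 := by
  refine ⟨⟨FanoFibre.labelIso, fun _ => rfl, fun _ => rfl, fun t ht => ?_⟩,
    fun t ht => FanoFibre.card_le_three ht, inferInstance,
    FanoFibre.nonempty_fundamentalGroup_equiv, FanoFibre.betti_one, FanoFibre.betti_two⟩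
  rw [FanoFibre.triangle_mem_faces_iff ht]
  refine and_congr (forall₅_congr fun v _ w _ hne => ?_) Iff.rfl
  exact ⟨fun h => ⟨fun e => hne (FanoFibre.label_bijective.1 e), h⟩, fun h => h.2⟩
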